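/- Let $n\ge 4$ and $k=n-2$, and let $\mathfrak S_n$ be the symmetric group on $[n]=\{1,\dots,n\}$ with simple transpositions $s_1,\dots,s_{n-1}$. Consider the following five graphs. 1. $\mathcal G_{{}_nw}$, the graph of reduced words of the permutation ${}_nw=[n,1,2,\dots,n-4,n-2,n-1,n-3]$ (one-line notation): its vertices are the reduced words $a_1\cdots a_p$ of ${}_nw$ (that is, ${}_nw=s_{a_1}\cdots s_{a_p}$ with $p=\ell({}_nw)$ the number of inversions), and two reduced words are adjacent when one is obtained from the other by a single commutation relation $ij\leftrightarrow ji$ ($|i-j|>1$) or a single braid relation $i\,(i+1)\,i\leftrightarrow (i+1)\,i\,(i+1)$, applied to consecutive letters. 2. $\mathcal H_{\mathcal C_{n-2,1,1}}$, the Hasse diagram of the poset $\mathcal C_{n-2,1,1}$ of recording tableaux: fillings of the hook shape $(n-2,1,1)$ by the numbers $1,\dots,n$, each used once, with first row $m_1<\dots<m_{n-2}$ and with entries $n_1$ in the second row and $n_2$ in the third row satisfying $n_1>n_2$; here $\tau\le\tau'$ means $m_i\ge m_i'$ for all $i$, $n_1\le n_1'$ and $n_2\le n_2'$. 3. $\mathcal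 H_{\mathcal R_n}$, the Hasse diagram of the set $\mathcal R_n$ of row readings $[n_2,n_1,m_1,\dots,m_{n-2}]\in\mathfrak S_n$ of the recording tableaux, with the order induced by the strong Bruhat order of $\mathfrak S_n$ (generated by $v<v'$ whenever $v'$ is obtained from $v$ by exchanging two entries $v_i<v_j$ with $i<j$). 4. $\mathcal Y_{\square_{k\times2}}$, the Hasse diagram of Young's lattice restricted to the partitions $\lambda=(\lambda_1\ge\lambda_2\ge0)$ with $\lambda_1\le k$, ordered by containment of Young diagrams. 5. $\mathcal G_{k\Delta_2}$, the graph on the lattice points $k\Delta_2\cap\mathbb Z_{\ge0}^2=\{(a_1,a_2)\in\mathbb Z_{\ge0}^2: a_1+a_2\le k\}$, constructed as follows. Write $\mathbf a<_{\rm lex}\mathbf b$ if the first coordinate of $\mathbf a-\mathbf b$ is negative; say that $\mathbf b$ lex-covers $\mathbf a$ if $\mathbf a<_{\rm lex}\mathbf b$ and no lattice point $\mathbf c$ of $k\Delta_2$ satisfies $\mathbf a<_{\rm lex}\mathbf c<_{\rm lex}\mathbf b$; and let $\mathbf m_{\mathbf a}=a_1+2a_2$. Two lattice points are adjacent when one of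 them lex-covers the other and their weights $\mathbf m$ differ by exactly $1$. The lattice points are partially ordered by letting $\mathbf a\preceq\mathbf b$ when there is a path in this graph from $\mathbf a$ to $\mathbf b$ along which the weight increases by $1$ at every step. Then $$\mathcal G_{{}_nw}\;\cong\;\mathcal H_{\mathcal C_{n-2,1,1}}\;\cong\;\mathcal H_{\mathcal R_n}\;\cong\;\mathcal Y_{\square_{k\times2}}\;\cong\;\mathcal G_{k\Delta_2}$$ as graphs. Moreover there is an isomorphism of posets from $(k\Delta_2\cap\mathbb Z_{\ge0}^2,\preceq)$ to $\mathcal R_n$ with the induced Bruhat order, which is also an isomorphism of the graphs $\mathcal G_{k\Delta_2}$ and $\mathcal H_{\mathcal R_n}$. -/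

import Mathlib

namespace HookWords

/-! Conventions: the set `[n] = {1, …, n}` is modelled by `Fin n`, the number `j` being the element
of `Fin n` with value `j - 1`.  A permutation `w` of `Fin n` has the one-line notation
`[w 0 + 1, w 1 + 1, …, w (n - 1) + 1]`, and products of permutations are compositions.
Letters of words are natural numbers counted from `1`. -/

/-- The length of a permutation: its number of inversions. -/
def length {n : ℕ} (w : Equiv.Perm (Fin n)) : ℕ :=
  (Finset.univ.filter fun p : Fin n × Fin n => p.1 < p.2 ∧ w p.2 < w p.1).card

/-- The simple transposition `s_i = (i, i + 1)` for `1 ≤ i ≤ n - 1` (and `1` for other `i`). -/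
def simpleTransposition (n i : ℕ) : Equiv.Perm (Fin n) :=
  if h : 1 ≤ i ∧ i < n then Equiv.swap ⟨i - 1, by omega⟩ ⟨i, h.2⟩ else 1

/-- `a = a₁ a₂ ⋯ a_p` is a reduced word of `w`: the letters lie in `{1, …, n - 1}`,
`w = s_{a₁} s_{a₂} ⋯ s_{a_p}`, and `p` is the length of `w`. -/
def IsReducedWord {n : ℕ} (w : Equiv.Perm (Fin n)) (a : List ℕ) : Prop :=
  (∀ i ∈ a, 1 ≤ i ∧ i < n) ∧ (a.map (simpleTransposition n)).prod = w ∧ a.length = length w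

/-- One application of a commutation relation or of a braid relation to a word. -/
inductive WordMove : List ℕ → List ℕ → Prop
  | commutation (u v : List ℕ) (i j : ℕ) (h : i + 1 < j ∨ j + 1 < i) :
      WordMove (u ++ [i, j] ++ v) (u ++ [j, i] ++ v)
  | braid (u v : List ℕ) (i : ℕ) :
      WordMove (u ++ [i, i + 1, i] ++ v) (u ++ [i + 1, i, i + 1] ++ v)

/-- The graph of reduced words of `w`: two reduced words are joined when they differ by one
commutation or one braid relation. -/
def reducedWordGraph {n : ℕ} (w : Equiv.Perm (Fin n)) :
    SimpleGraph {a : List ℕ // IsReducedWord w a} :=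
  SimpleGraph.fromRel fun a b => WordMove a.1 b.1

/-- The one-line notation `[n, 1, 2, …, n - 4, n - 2, n - 1, n - 3]` as a function. -/
def hookFun (n : ℕ) (h : 4 ≤ n) (i : Fin n) : Fin n :=
  if i.1 = 0 then ⟨n - 1, by omega⟩
  else if i.1 + 4 ≤ n then ⟨i.1 - 1, by omega⟩
  else if i.1 + 1 = n then ⟨n - 4, by omega⟩
  else i

theorem hookFun_injective (n : ℕ) (h : 4 ≤ n) : Function.Injective (hookFun n h) := by
  intro i j hij
  have hi := i.2
  have hj := j.2
  simp only [hookFun] at hij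
  apply Fin.ext
  split_ifs at hij <;> simp only [Fin.ext_iff] at hij <;> omega

/-- The permutation `ₙw = [n, 1, 2, …, n - 4, n - 2, n - 1, n - 3]`, for `n ≥ 4`. -/
noncomputable def hookPerm (n : ℕ) (h : 4 ≤ n) : Equiv.Perm (Fin n) :=
  Equiv.ofBijective (hookFun n h) (Finite.injective_iff_bijective.mp (hookFun_injective n h))

/-- A recording row-strict tableau of shape `(n - 2, 1, 1)`: a filling with the numbers of `[n]`,
each used once, whose first row `row` increases strictly and whose entries `mid` (second row) and
`bot` (third row) decrease strictly downward. -/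
@[ext] structure RecordingTableau (n : ℕ) where
  row : Fin (n - 2) → Fin n
  mid : Fin n
  bot : Fin n
  row_strictMono : StrictMono row
  row_ne_mid : ∀ i, row i ≠ mid
  row_ne_bot : ∀ i, row i ≠ bot
  bot_lt_mid : bot < mid

/-- `τ₁ ≤ τ₂` when the first-row entries of `τ₁` are at least those of `τ₂`, and the entries in
the second and third row are at most those of `τ₂`. -/
instance (n : ℕ) : PartialOrder (RecordingTableau n) where
  le s t := (∀ i, t.row i ≤ s.row i) ∧ s.mid ≤ t.mid ∧ s.bot ≤ t.bot
  le_refl s := ⟨fun _ => le_rfl, le_rfl, le_rfl⟩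
  le_trans _ _ _ h₁ h₂ :=
    ⟨fun i => (h₂.1 i).trans (h₁.1 i), h₁.2.1.trans h₂.2.1, h₁.2.2.trans h₂.2.2⟩
  le_antisymm _ _ h₁ h₂ := RecordingTableau.ext
    (funext fun i => le_antisymm (h₂.1 i) (h₁.1 i))
    (le_antisymm h₁.2.1 h₂.2.1) (le_antisymm h₁.2.2 h₂.2.2)

/-- The row reading of a tableau as a function: the rows are listed from the bottom upward, each
from left to right. -/
def RecordingTableau.readingFun {n : ℕ} (t : RecordingTableau n) (i : Fin n) : Fin n :=
  if i.1 = 0 then t.bot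
  else if h : i.1 < 2 then t.mid
  else t.row ⟨i.1 - 2, by have := i.2; omega⟩

theorem RecordingTableau.readingFun_injective {n : ℕ} (t : RecordingTableau n) :
    Function.Injective t.readingFun := by
  intro i j hij
  have hb := t.bot_lt_mid.ne
  apply Fin.ext
  simp only [readingFun] at hij
  split_ifs at hij
  all_goals first
    | omega
    | exact absurd hij hb
    | exact absurd hij.symm hb
    | exact absurd hij (t.row_ne_mid _)
    | exact absurd hij.symm (t.row_ne_mid _)
    | exact absurd hij (t.row_ne_bot _)
    | exact absurd hij.symm (t.row_ne_bot _)
    | (have h := t.row_strictMono.injective hij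
       simp only [Fin.mk.injEq] at h
       omega)

/-- The row reading of a tableau, as a permutation. -/
noncomputable def RecordingTableau.reading {n : ℕ} (t : RecordingTableau n) :
    Equiv.Perm (Fin n) :=
  Equiv.ofBijective t.readingFun (Finite.injective_iff_bijective.mp t.readingFun_injective)

/-- One step up in the strong Bruhat order: exchange the values at two positions `i < j` at which
they are in increasing order. -/
def BruhatStep {n : ℕ} (v w : Equiv.Perm (Fin n)) : Prop :=
  ∃ i j : Fin n, i < j ∧ v i < v j ∧ w = v * Equiv.swap i j

/-- The strong Bruhat order on the symmetric group. -/
def BruhatLE {n : ℕ} : Equiv.Perm (Fin n) → Equiv.Perm (Fin n) → Prop :=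
  Relation.ReflTransGen BruhatStep

/-- Auxiliary statistic, strictly decreasing along Bruhat steps. -/
def moment {n : ℕ} (w : Equiv.Perm (Fin n)) : ℤ := ∑ i : Fin n, (i.1 : ℤ) * ((w i).1 : ℤ)

theorem BruhatStep.moment_lt {n : ℕ} {v w : Equiv.Perm (Fin n)} (h : BruhatStep v w) :
    moment w < moment v := by
  obtain ⟨i, j, hij, hv, rfl⟩ := h
  have hne : i ≠ j := hij.ne
  have key : moment v - moment (v * Equiv.swap i j) =
      ((j.1 : ℤ) - i.1) * ((v j).1 - (v i).1) := by
    unfold moment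
    rw [← Finset.sum_sub_distrib]
    rw [Finset.sum_eq_add_of_mem i j (Finset.mem_univ _) (Finset.mem_univ _) hne]
    · simp only [Equiv.Perm.mul_apply, Equiv.swap_apply_left, Equiv.swap_apply_right]
      ring
    · intro c _ hc
      simp only [Equiv.Perm.mul_apply, Equiv.swap_apply_of_ne_of_ne hc.1 hc.2, sub_self]
  have h1 : (0 : ℤ) < (j.1 : ℤ) - i.1 := by
    have : i.1 < j.1 := hij
    omega
  have h2 : (0 : ℤ) < ((v j).1 : ℤ) - (v i).1 := by
    have : (v i).1 < (v j).1 := hv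
    omega
  have := mul_pos h1 h2
  omega

theorem BruhatLE.eq_or_moment_lt {n : ℕ} {v w : Equiv.Perm (Fin n)} (h : BruhatLE v w) :
    v = w ∨ moment w < moment v := by
  induction h with
  | refl => exact Or.inl rfl
  | tail _ h ih =>
    rcases ih with rfl | ih
    · exact Or.inr h.moment_lt
    · exact Or.inr (h.moment_lt.trans ih)

theorem BruhatLE.antisymm {n : ℕ} {v w : Equiv.Perm (Fin n)} (h₁ : BruhatLE v w)
    (h₂ : BruhatLE w v) : v = w := by
  rcases h₁.eq_or_moment_lt with h | h
  · exact h
  · rcases h₂.eq_or_moment_lt with h' | h'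
    · exact h'.symm
    · exact absurd h' (not_lt.mpr h.le)

/-- The set of row readings of the recording tableaux of shape `(n - 2, 1, 1)`. -/
def RowReading (n : ℕ) : Type :=
  {w : Equiv.Perm (Fin n) // ∃ t : RecordingTableau n, t.reading = w}

/-- Row readings are ordered by the strong Bruhat order of the whole symmetric group. -/
instance (n : ℕ) : PartialOrder (RowReading n) where
  le v w := BruhatLE v.1 w.1
  le_refl _ := Relation.ReflTransGen.refl
  le_trans _ _ _ h₁ h₂ := Relation.ReflTransGen.trans h₁ h₂
  le_antisymm _ _ h₁ h₂ := Subtype.ext (BruhatLE.antisymm h₁ h₂)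

/-- The partitions `(λ₁ ≥ λ₂)` with `λ₁ ≤ k`, as Young diagrams with at most two rows, each with at
most `k` boxes, ordered by containment. -/
abbrev FittedPartition (k : ℕ) : Type :=
  {μ : YoungDiagram // ∀ c ∈ μ.cells, c.1 < 2 ∧ c.2 < k}

/-- The `k`-fold dilation of the standard `2`-simplex. -/
def dilatedSimplex (k : ℕ) : Set (ℝ × ℝ) := {x | 0 ≤ x.1 ∧ 0 ≤ x.2 ∧ x.1 + x.2 ≤ k}

/-- The lattice points with nonnegative integer coordinates in the dilated simplex. -/
def LatticePoint (k : ℕ) : Type :=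
  {a : ℕ × ℕ // ((a.1 : ℝ), (a.2 : ℝ)) ∈ dilatedSimplex k}

/-- `a <_lex b`: the first coordinate of the difference `a - b` is negative. -/
def LatticePoint.LexLT {k : ℕ} (a b : LatticePoint k) : Prop := (a.1.1 : ℤ) - b.1.1 < 0

/-- `b` covers `a` with respect to `<_lex`. -/
def LatticePoint.LexCovers {k : ℕ} (a b : LatticePoint k) : Prop :=
  a.LexLT b ∧ ¬ ∃ c : LatticePoint k, a.LexLT c ∧ c.LexLT b

/-- The weight `a₁ + 2 a₂` of a lattice point. -/
def LatticePoint.weight {k : ℕ} (a : LatticePoint k) : ℕ := a.1.1 + 2 * a.1.2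

/-- A step up between lattice points: one of the two points covers the other one with respect to
`<_lex`, and the weight, which is the rank, grows by one. -/
def LatticePoint.Step {k : ℕ} (a b : LatticePoint k) : Prop :=
  (a.LexCovers b ∨ b.LexCovers a) ∧ b.weight = a.weight + 1

/-- The graph of lattice points: two points are joined when one of them covers the other one with
respect to `<_lex` and their weights are consecutive. -/
def latticePointGraph (k : ℕ) : SimpleGraph (LatticePoint k) where
  Adj a b := a.Step b ∨ b.Step a
  symm := ⟨fun _ _ h => h.symm⟩
  loopless := ⟨fun a h => by
    rcases h with h | h <;> exact absurd h.2 (by omega)⟩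

theorem LatticePoint.eq_or_weight_lt {k : ℕ} {a b : LatticePoint k}
    (h : Relation.ReflTransGen LatticePoint.Step a b) : a = b ∨ a.weight < b.weight := by
  induction h with
  | refl => exact Or.inl rfl
  | tail _ h ih =>
    have := h.2
    rcases ih with rfl | ih
    · exact Or.inr (by omega)
    · exact Or.inr (by omega)

/-- The partial order on lattice points generated by the steps. -/
instance (k : ℕ) : PartialOrder (LatticePoint k) where
  le a b := Relation.ReflTransGen LatticePoint.Step a b
  le_refl _ := Relation.ReflTransGen.refl
  le_trans _ _ _ h₁ h₂ := Relation.ReflTransGen.trans h₁ h₂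
  le_antisymm a b h₁ h₂ := by
    rcases LatticePoint.eq_or_weight_lt h₁ with h | h
    · exact h
    · rcases LatticePoint.eq_or_weight_lt h₂ with h' | h'
      · exact h'.symm
      · omega

end HookWords

namespace HookWords

/-! All five objects are compared with one poset, the staircase of pairs `(p, q)` with `q ≤ p ≤ n -
2` under the componentwise order, whose covers are the unit steps.

Words: `(n-1)(n-2)⋯1(n-2)(n-1)` is reduced for `ₙw`. Its penultimate letter `n-2` can travel left
through the descending run by `p` moves and the final `n-1` can follow by `q ≤ p` moves. Each move
is a commutation, except for one braid relation on each journey. The two ascents of a word recover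
`(p, q)`. A case analysis shows that every move applicable to such a word changes `(p, q)` by a unit
step (`exists_letter_of_positionMove`), so the family is closed under moves; by Matsumoto's theorem
(`IsReducedWord.eqvGen_wordMove`) it contains all reduced words.

Tableaux: the two entries below the first row, `q < p + 1` counted from `0`, determine the filling,
and the first-row inequalities follow from those two. For row readings, the first entry and the
maximum of the first two are monotone along all Bruhat steps, and conversely a unit step is a single
Bruhat step (`bruhatLE_reading_iff`).

Partitions are the pairs of row lengths. For lattice points put `p = a₁ + a₂`, `q = a₂`: the
coordinate `a₁` changes by one and the weight rises by one exactly when `(p, q)` makes a unit step.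
-/

/-! ### Simple transpositions, left descents and length. -/

/-- The simple transposition in the letter `i`, for a valid letter, with values counted from `0`. -/
theorem simpleTransposition_val {n i : ℕ} (h1 : 1 ≤ i) (h2 : i < n) (x : Fin n) :
    (simpleTransposition n i x).1 = if x.1 + 1 = i then i else if x.1 = i then i - 1 else x.1 := by
  rw [simpleTransposition, dif_pos ⟨h1, h2⟩, Equiv.swap_apply_def]
  simp only [Fin.ext_iff]
  split_ifs <;> first | omega | simp_all

theorem simpleTransposition_mul_self (n i : ℕ) :
    simpleTransposition n i * simpleTransposition n i = 1 := by
  unfold simpleTransposition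
  split_ifs <;> simp

theorem simpleTransposition_mul_cancel (n i : ℕ) (w : Equiv.Perm (Fin n)) :
    simpleTransposition n i * (simpleTransposition n i * w) = w := by
  rw [← mul_assoc, simpleTransposition_mul_self, one_mul]

theorem simpleTransposition_comm {n i j : ℕ} (hi : 1 ≤ i ∧ i < n) (hj : 1 ≤ j ∧ j < n)
    (h : i + 1 < j ∨ j + 1 < i) :
    simpleTransposition n i * simpleTransposition n j =
      simpleTransposition n j * simpleTransposition n i := by
  ext x
  simp only [Equiv.Perm.mul_apply, simpleTransposition_val hi.1 hi.2,
    simpleTransposition_val hj.1 hj.2]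
  split_ifs <;> omega

theorem simpleTransposition_braid {n i : ℕ} (hi : 1 ≤ i) (hj : i + 1 < n) :
    simpleTransposition n i * simpleTransposition n (i + 1) * simpleTransposition n i =
      simpleTransposition n (i + 1) * simpleTransposition n i * simpleTransposition n (i + 1) := by
  ext x
  simp only [Equiv.Perm.mul_apply, simpleTransposition_val hi (by omega : i < n),
    simpleTransposition_val (by omega : 1 ≤ i + 1) hj]
  generalize x.1 = y
  obtain ⟨i, rfl⟩ := Nat.exists_eq_add_of_le' hi
  obtain h | h | h | ⟨h1, h2, h3⟩ :
      y = i ∨ y = i + 1 ∨ y = i + 2 ∨ (y ≠ i ∧ y ≠ i + 1 ∧ y ≠ i + 2) := by omega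
  all_goals simp [show i ≠ i + 1 + 1 by omega, show i + 1 + 1 ≠ i by omega, *]

/-- The letter `i` is a left descent of `w`: the value `i + 1` stands to the left of `i`. -/
def IsLeftDescent {n : ℕ} (w : Equiv.Perm (Fin n)) (i : ℕ) : Prop :=
  ∀ x y : Fin n, (w x).1 + 1 = i → (w y).1 = i → y < x

/-- Left multiplication exchanges two neighbouring values, so the set of inverted position pairs
only gains the pair holding these values. -/
theorem length_simpleTransposition_mul {n i : ℕ} (hi : 1 ≤ i ∧ i < n) {w : Equiv.Perm (Fin n)}
    (h : ¬ IsLeftDescent w i) : length (simpleTransposition n i * w) = length w + 1 := by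
  unfold IsLeftDescent at h
  push Not at h
  obtain ⟨x, y, hx, hy, hxy⟩ := h
  have hne : x ≠ y := by rintro rfl; omega
  have hlt : x < y := lt_of_le_of_ne hxy hne
  unfold length
  rw [← Finset.card_insert_of_notMem (a := (x, y))]
  · congr 1
    ext ⟨a, b⟩
    have ha : w a = w x ↔ a = x := w.injective.eq_iff
    have hb : w b = w x ↔ b = x := w.injective.eq_iff
    have ha' : w a = w y ↔ a = y := w.injective.eq_iff
    have hb' : w b = w y ↔ b = y := w.injective.eq_iff
    have hab : w a = w b ↔ a = b := w.injective.eq_iff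
    simp only [Fin.ext_iff] at ha hb ha' hb' hab
    simp only [Finset.mem_insert, Finset.mem_filter, Finset.mem_univ, true_and, Prod.mk.injEq,
      Equiv.Perm.mul_apply, Fin.lt_def, simpleTransposition_val hi.1 hi.2, Fin.ext_iff] at *
    split_ifs <;> omega
  · simp only [Finset.mem_filter, Finset.mem_univ, true_and, Fin.lt_def]
    omega

theorem isLeftDescent_simpleTransposition_mul {n i : ℕ} (hi : 1 ≤ i ∧ i < n)
    (w : Equiv.Perm (Fin n)) :
    IsLeftDescent (simpleTransposition n i * w) i ↔ ¬ IsLeftDescent w i := by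
  unfold IsLeftDescent
  constructor
  · intro h h'
    obtain ⟨a, ha⟩ := w.surjective ⟨i - 1, by omega⟩
    obtain ⟨b, hb⟩ := w.surjective ⟨i, hi.2⟩
    rw [Fin.ext_iff] at ha hb
    dsimp only at ha hb
    have hx := h b a
    have hy := h' a b (by omega) (by omega)
    simp only [Equiv.Perm.mul_apply, simpleTransposition_val hi.1 hi.2] at hx
    have := hx (by split_ifs <;> omega) (by split_ifs <;> omega)
    omega
  · intro h x y hx hy
    push Not at h
    obtain ⟨a, b, ha, hb, hab⟩ := h
    simp only [Equiv.Perm.mul_apply, simpleTransposition_val hi.1 hi.2] at hx hy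
    have h1 : x = b := w.injective (Fin.ext (by split_ifs at hx <;> omega))
    have h2 : y = a := w.injective (Fin.ext (by split_ifs at hy <;> omega))
    subst h1 h2
    refine lt_of_le_of_ne hab ?_
    rintro rfl
    omega

theorem length_simpleTransposition_mul_add_one {n i : ℕ} (hi : 1 ≤ i ∧ i < n)
    {w : Equiv.Perm (Fin n)} (h : IsLeftDescent w i) :
    length (simpleTransposition n i * w) + 1 = length w := by
  have h1 : ¬ IsLeftDescent (simpleTransposition n i * w) i := fun h' =>
    (isLeftDescent_simpleTransposition_mul hi w).1 h' h
  have := length_simpleTransposition_mul hi h1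
  rwa [simpleTransposition_mul_cancel, eq_comm] at this

theorem length_one (n : ℕ) : length (1 : Equiv.Perm (Fin n)) = 0 := by
  unfold length
  rw [Finset.card_eq_zero, Finset.filter_eq_empty_iff]
  rintro ⟨a, b⟩ -
  simp only [Equiv.Perm.one_apply]
  exact fun h => absurd h.1 h.2.asymm

theorem length_prod_le {n : ℕ} (a : List ℕ) (ha : ∀ i ∈ a, 1 ≤ i ∧ i < n) :
    length (a.map (simpleTransposition n)).prod ≤ a.length := by
  induction a with
  | nil => simp [length_one]
  | cons i u ih =>
    have h1 := ih fun j hj => ha j (List.mem_cons_of_mem _ hj)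
    have hi := ha i List.mem_cons_self
    rw [List.map_cons, List.prod_cons, List.length_cons]
    by_cases h : IsLeftDescent (u.map (simpleTransposition n)).prod i
    · have := length_simpleTransposition_mul_add_one hi h
      omega
    · have := length_simpleTransposition_mul hi h
      omega

/-- Peeling off the first letter makes induction on the length possible. The first letter must be a
descent: otherwise `s_i w` would be longer than `w` although `u` spells it with fewer letters. -/
theorem isReducedWord_cons {n i : ℕ} {u : List ℕ} {w : Equiv.Perm (Fin n)} :
    IsReducedWord w (i :: u) ↔
      (1 ≤ i ∧ i < n) ∧ IsLeftDescent w i ∧ IsReducedWord (simpleTransposition n i * w) u := by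
  unfold IsReducedWord
  rw [List.forall_mem_cons, List.map_cons, List.prod_cons, List.length_cons]
  constructor
  · rintro ⟨⟨hi, hu⟩, hw, hl⟩
    have hw' : (u.map (simpleTransposition n)).prod = simpleTransposition n i * w := by
      rw [← hw, simpleTransposition_mul_cancel]
    have hle := length_prod_le u hu
    rw [hw'] at hle
    have hd : IsLeftDescent w i := by
      by_contra h
      have := length_simpleTransposition_mul hi h
      omega
    have := length_simpleTransposition_mul_add_one hi hd
    exact ⟨hi, hd, hu, hw', by omega⟩
  · rintro ⟨hi, hd, hu, hw, hl⟩
    have := length_simpleTransposition_mul_add_one hi hd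
    exact ⟨⟨hi, hu⟩, by rw [hw, simpleTransposition_mul_cancel], by omega⟩

/-- Without left descents the inverse is strictly increasing, and the identity is the only order
automorphism of `Fin n`. -/
theorem eq_one_of_forall_not_isLeftDescent {n : ℕ} {w : Equiv.Perm (Fin n)}
    (h : ∀ i, 1 ≤ i ∧ i < n → ¬ IsLeftDescent w i) : w = 1 := by
  have hs : StrictMono (w⁻¹ : Equiv.Perm (Fin n)) := by
    rcases n with _ | n
    · exact fun x => x.elim0
    · rw [Fin.strictMono_iff_lt_succ]
      intro i
      have hi := h (i.1 + 1) ⟨by omega, by omega⟩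
      unfold IsLeftDescent at hi
      push Not at hi
      obtain ⟨x, y, hx, hy, hxy⟩ := hi
      have h1 : w x = i.castSucc := Fin.ext (by simpa using hx)
      have h2 : w y = i.succ := Fin.ext (by simpa using hy)
      have h3 : ∀ z, w⁻¹ (w z) = z := w.symm_apply_apply
      rw [← h1, ← h2, h3, h3]
      refine lt_of_le_of_ne hxy ?_
      rintro rfl
      omega
  have h1 : hs.orderIsoOfSurjective _ (w⁻¹).surjective = OrderIso.refl _ := Subsingleton.elim _ _
  have h2 : w⁻¹ = 1 := Equiv.ext fun x => congrArg (fun e : Fin n ≃o Fin n => e x) h1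
  simpa using h2

theorem exists_isReducedWord {n : ℕ} (w : Equiv.Perm (Fin n)) : ∃ a, IsReducedWord w a := by
  induction hl : length w using Nat.strong_induction_on generalizing w with
  | _ l ih =>
    by_cases h : ∀ i, 1 ≤ i ∧ i < n → ¬ IsLeftDescent w i
    · obtain rfl := eq_one_of_forall_not_isLeftDescent h
      exact ⟨[], by simp [IsReducedWord, length_one]⟩
    · push Not at h
      obtain ⟨i, hi, hd⟩ := h
      have := length_simpleTransposition_mul_add_one hi hd
      obtain ⟨u, hu⟩ := ih _ (by omega) (simpleTransposition n i * w) rfl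
      exact ⟨i :: u, isReducedWord_cons.2 ⟨hi, hd, hu⟩⟩

/-! ### Matsumoto's theorem. -/

theorem WordMove.cons {a b : List ℕ} (i : ℕ) (h : WordMove a b) : WordMove (i :: a) (i :: b) := by
  cases h with
  | commutation u v k l h => exact .commutation (i :: u) v k l h
  | braid u v k => exact .braid (i :: u) v k

theorem eqvGen_wordMove_cons {a b : List ℕ} (i : ℕ) (h : Relation.EqvGen WordMove a b) :
    Relation.EqvGen WordMove (i :: a) (i :: b) := by
  induction h with
  | rel _ _ h => exact .rel _ _ (h.cons i)
  | refl => exact .refl _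
  | symm _ _ _ ih => exact .symm _ _ ih
  | trans _ _ _ _ _ ih₁ ih₂ => exact .trans _ _ _ ih₁ ih₂

theorem IsLeftDescent.simpleTransposition_mul_of_far {n i j : ℕ} {w : Equiv.Perm (Fin n)}
    (hi : 1 ≤ i ∧ i < n) (hij : i + 1 < j ∨ j + 1 < i) (h : IsLeftDescent w j) :
    IsLeftDescent (simpleTransposition n i * w) j := by
  intro x y hx hy
  simp only [Equiv.Perm.mul_apply, simpleTransposition_val hi.1 hi.2] at hx hy
  exact h x y (by split_ifs at hx <;> omega) (by split_ifs at hy <;> omega)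

/-- The three consecutive values `i - 1, i, i + 1` (from `0`) stand in decreasing order, so both `i,
i + 1, i` and `i + 1, i, i + 1` can begin a reduced word. -/
theorem IsLeftDescent.simpleTransposition_mul_succ {n i : ℕ} {w : Equiv.Perm (Fin n)}
    (hi : 1 ≤ i ∧ i + 1 < n) (h : IsLeftDescent w i) (h' : IsLeftDescent w (i + 1)) :
    IsLeftDescent (simpleTransposition n i * w) (i + 1) ∧
      IsLeftDescent (simpleTransposition n (i + 1) * w) i ∧
      IsLeftDescent (simpleTransposition n (i + 1) * (simpleTransposition n i * w)) i ∧
      IsLeftDescent (simpleTransposition n i * (simpleTransposition n (i + 1) * w)) (i + 1) := by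
  obtain ⟨a, ha⟩ := w.surjective ⟨i - 1, by omega⟩
  obtain ⟨b, hb⟩ := w.surjective ⟨i, by omega⟩
  obtain ⟨c, hc⟩ := w.surjective ⟨i + 1, by omega⟩
  have hba : b < a := h a b (by rw [ha]; simp; omega) (by rw [hb])
  have hcb : c < b := h' b c (by rw [hb]) (by rw [hc])
  have ea : ∀ x, (w x).1 = i - 1 → x = a := fun x hx => w.injective (by rw [ha]; exact Fin.ext hx)
  have eb : ∀ x, (w x).1 = i → x = b := fun x hx => w.injective (by rw [hb]; exact Fin.ext hx)
  have ec : ∀ x, (w x).1 = i + 1 → x = c := fun x hx => w.injective (by rw [hc]; exact Fin.ext hx)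
  refine ⟨?_, ?_, ?_, ?_⟩ <;> intro x y hx hy <;>
    simp only [Equiv.Perm.mul_apply, simpleTransposition_val hi.1 (by omega : i < n),
      simpleTransposition_val (by omega : 1 ≤ i + 1) hi.2] at hx hy
  · obtain rfl := ea x (by split_ifs at hx <;> omega)
    obtain rfl := ec y (by split_ifs at hy <;> omega)
    exact hcb.trans hba
  · obtain rfl := ea x (by split_ifs at hx <;> omega)
    obtain rfl := ec y (by split_ifs at hy <;> omega)
    exact hcb.trans hba
  · obtain rfl := eb x (by split_ifs at hx <;> omega)
    obtain rfl := ec y (by split_ifs at hy <;> omega)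
    exact hcb
  · obtain rfl := ea x (by split_ifs at hx <;> omega)
    obtain rfl := eb y (by split_ifs at hy <;> omega)
    exact hba

/-- Matsumoto's theorem for the symmetric group: two reduced words of the same permutation are
connected by commutation and braid relations. -/
theorem IsReducedWord.eqvGen_wordMove {n : ℕ} {w : Equiv.Perm (Fin n)} {a b : List ℕ}
    (ha : IsReducedWord w a) (hb : IsReducedWord w b) : Relation.EqvGen WordMove a b := by
  induction hl : length w using Nat.strong_induction_on generalizing w a b with
  | _ l ih =>
    have hal := ha.2.2
    have hbl := hb.2.2
    rcases a with _ | ⟨i, u⟩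
    · rcases b with _ | ⟨j, v⟩
      · exact .refl _
      · simp only [List.length_nil, List.length_cons] at hal hbl
        omega
    rcases b with _ | ⟨j, v⟩
    · simp only [List.length_nil, List.length_cons] at hal hbl
      omega
    -- With `t` a common reduced tail, induction connects `u` to `(i + 1) i t` and `v` to `i (i + 1)
    -- t`; one braid relation joins the two extended words. The far case below uses a commutation in
    -- the same way.
    have braidCase : ∀ (i : ℕ) (u v : List ℕ), IsReducedWord w (i :: u) →
        IsReducedWord w ((i + 1) :: v) →
        Relation.EqvGen WordMove (i :: u) ((i + 1) :: v) := by
      intro i u v hiu hjv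
      obtain ⟨hi, hdi, hu⟩ := isReducedWord_cons.1 hiu
      obtain ⟨hj, hdj, hv⟩ := isReducedWord_cons.1 hjv
      obtain ⟨d1, d2, d3, d4⟩ := hdi.simpleTransposition_mul_succ ⟨hi.1, hj.2⟩ hdj
      have e := simpleTransposition_braid hi.1 hj.2
      obtain ⟨t, ht⟩ := exists_isReducedWord (simpleTransposition n i *
        (simpleTransposition n (i + 1) * (simpleTransposition n i * w)))
      have ht' : IsReducedWord (simpleTransposition n (i + 1) *
          (simpleTransposition n i * (simpleTransposition n (i + 1) * w))) t := by
        simpa only [← mul_assoc, e] using ht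
      have l1 := length_simpleTransposition_mul_add_one hi hdi
      have l2 := length_simpleTransposition_mul_add_one hj hdj
      have h1 := ih _ (by omega) hu
        (isReducedWord_cons.2 ⟨hj, d1, isReducedWord_cons.2 ⟨hi, d3, ht⟩⟩) rfl
      have h2 := ih _ (by omega) hv
        (isReducedWord_cons.2 ⟨hi, d2, isReducedWord_cons.2 ⟨hj, d4, ht'⟩⟩) rfl
      exact .trans _ _ _ (eqvGen_wordMove_cons i h1) (.trans _ _ _
        (.rel _ _ (.braid [] t i)) (.symm _ _ (eqvGen_wordMove_cons (i + 1) h2)))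
    obtain ⟨hi, hdi, hu⟩ := isReducedWord_cons.1 ha
    obtain ⟨hj, hdj, hv⟩ := isReducedWord_cons.1 hb
    have l1 := length_simpleTransposition_mul_add_one hi hdi
    have l2 := length_simpleTransposition_mul_add_one hj hdj
    by_cases hij : i = j
    · subst hij
      exact eqvGen_wordMove_cons i (ih _ (by omega) hu hv rfl)
    by_cases h1 : j = i + 1
    · subst h1
      exact braidCase i u v ha hb
    by_cases h2 : i = j + 1
    · subst h2
      exact .symm _ _ (braidCase j v u hb ha)
    have hfar : i + 1 < j ∨ j + 1 < i := by omega
    have d1 := hdj.simpleTransposition_mul_of_far hi hfar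
    have d2 := hdi.simpleTransposition_mul_of_far hj hfar.symm
    obtain ⟨t, ht⟩ := exists_isReducedWord
      (simpleTransposition n j * (simpleTransposition n i * w))
    have ht' : IsReducedWord (simpleTransposition n i * (simpleTransposition n j * w)) t := by
      rwa [← mul_assoc, simpleTransposition_comm hi hj hfar, mul_assoc]
    have m1 := ih _ (by omega) hu (isReducedWord_cons.2 ⟨hj, d1, ht⟩) rfl
    have m2 := ih _ (by omega) hv (isReducedWord_cons.2 ⟨hi, d2, ht'⟩) rfl
    exact .trans _ _ _ (eqvGen_wordMove_cons i m1) (.trans _ _ _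
      (.rel _ _ (.commutation [] t i j hfar)) (.symm _ _ (eqvGen_wordMove_cons j m2)))

theorem WordMove.isReducedWord_iff {n : ℕ} {w : Equiv.Perm (Fin n)} {a b : List ℕ}
    (h : WordMove a b) : IsReducedWord w a ↔ IsReducedWord w b := by
  cases h with
  | commutation u v i j h =>
    have hm : (∀ x ∈ u ++ [i, j] ++ v, 1 ≤ x ∧ x < n) ↔
        ∀ x ∈ u ++ [j, i] ++ v, 1 ≤ x ∧ x < n := by
      simp only [List.mem_append, List.mem_cons, List.not_mem_nil, or_false]
      constructor <;> intro h x hx <;> exact h x (by tauto)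
    unfold IsReducedWord
    rw [← hm]
    refine and_congr_right fun hv => ?_
    have hi := hv i (by simp)
    have hj := hv j (by simp)
    simp only [List.map_append, List.map_cons, List.map_nil, List.prod_append, List.prod_cons,
      List.prod_nil, mul_one, List.length_append, List.length_cons, List.length_nil,
      simpleTransposition_comm hi hj h]
  | braid u v i =>
    have hm : (∀ x ∈ u ++ [i, i + 1, i] ++ v, 1 ≤ x ∧ x < n) ↔
        ∀ x ∈ u ++ [i + 1, i, i + 1] ++ v, 1 ≤ x ∧ x < n := by
      simp only [List.mem_append, List.mem_cons, List.not_mem_nil, or_false]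
      constructor <;> intro h x hx <;> exact h x (by tauto)
    unfold IsReducedWord
    rw [← hm]
    refine and_congr_right fun hv => ?_
    have hi := hv i (by simp)
    have hj := hv (i + 1) (by simp)
    have e := simpleTransposition_braid hi.1 hj.2
    simp only [List.map_append, List.map_cons, List.map_nil, List.prod_append, List.prod_cons,
      List.prod_nil, mul_one, List.length_append, List.length_cons, List.length_nil]
    rw [← mul_assoc (simpleTransposition n i), e, mul_assoc (simpleTransposition n (i + 1))]

/-! ### The staircase poset. -/

/-- The pairs `(p, q)` with `q ≤ p ≤ k`, ordered componentwise. -/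
abbrev Staircase (k : ℕ) : Type := {a : ℕ × ℕ // a.2 ≤ a.1 ∧ a.1 ≤ k}

/-- One of the two coordinates grows by one. -/
def UnitStep (a b : ℕ × ℕ) : Prop :=
  (b.1 = a.1 + 1 ∧ b.2 = a.2) ∨ (b.1 = a.1 ∧ b.2 = a.2 + 1)

theorem Staircase.le_iff {k : ℕ} {a b : Staircase k} :
    a ≤ b ↔ a.1.1 ≤ b.1.1 ∧ a.1.2 ≤ b.1.2 := Iff.rfl

theorem Staircase.lt_iff {k : ℕ} {a b : Staircase k} :
    a < b ↔ (a.1.1 ≤ b.1.1 ∧ a.1.2 ≤ b.1.2) ∧ (a.1.1 < b.1.1 ∨ a.1.2 < b.1.2) := by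
  rw [lt_iff_le_not_ge, le_iff, le_iff]
  omega

/-- Below any strictly larger `b` there is a unit step from `a`: raise the first coordinate if it
differs, otherwise the second, which is allowed since `q' ≤ p' = p`. -/
theorem Staircase.covBy_iff {k : ℕ} {a b : Staircase k} : a ⋖ b ↔ UnitStep a.1 b.1 := by
  obtain ⟨⟨p, q⟩, hq, hp⟩ := a
  obtain ⟨⟨p', q'⟩, hq', hp'⟩ := b
  simp only [UnitStep] at *
  constructor
  · rintro ⟨h, h'⟩
    simp only [lt_iff] at h
    by_cases h1 : p < p'
    · have := @h' ⟨(p + 1, q), by dsimp only; omega⟩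
      simp only [lt_iff] at this
      omega
    · have := @h' ⟨(p, q + 1), by dsimp only; omega⟩
      simp only [lt_iff] at this
      omega
  · intro h
    refine ⟨by simp only [lt_iff]; omega, ?_⟩
    rintro ⟨⟨r, s⟩, hs, hr⟩ h1 h2
    simp only [lt_iff] at h1 h2
    omega

/-- Raising the first coordinate completely before the second keeps the path inside `q ≤ p`. -/
theorem Staircase.reflTransGen_of_le {k : ℕ} {a b : Staircase k} (h : a ≤ b) :
    Relation.ReflTransGen (fun a b : Staircase k => UnitStep a.1 b.1) a b := by
  obtain ⟨⟨p, q⟩, hq, hp⟩ := a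
  obtain ⟨⟨p', q'⟩, hq', hp'⟩ := b
  rw [le_iff] at h
  dsimp only at *
  have h1 : ∀ r (hr : q ≤ r ∧ r ≤ k), p ≤ r →
      Relation.ReflTransGen (fun a b : Staircase k => UnitStep a.1 b.1)
        ⟨(p, q), hq, hp⟩ ⟨(r, q), hr⟩ := by
    intro r hr hpr
    induction r, hpr using Nat.le_induction with
    | base => exact .refl
    | succ r hpr ih => exact .tail (ih ⟨by omega, by omega⟩) (.inl ⟨rfl, rfl⟩)
  have h2 : ∀ s (hs : s ≤ p' ∧ p' ≤ k), q ≤ s →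
      Relation.ReflTransGen (fun a b : Staircase k => UnitStep a.1 b.1)
        ⟨(p, q), hq, hp⟩ ⟨(p', s), hs⟩ := by
    intro s hs hqs
    induction s, hqs using Nat.le_induction with
    | base => exact h1 p' hs h.1
    | succ s hqs ih => exact .tail (ih ⟨by omega, by omega⟩) (.inr ⟨rfl, rfl⟩)
  exact h2 q' ⟨hq', hp'⟩ h.2

/-! ### The explicit family of words. -/

/-- The letter at position `t` (counted from `0`) of the reduced word of `ₙw` whose ascents are at
the positions `n - 2 - p` and `n - 1 - q`. -/
def letter (n p q t : ℕ) : ℕ :=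
  if n < t + q then n + 1 - t
  else if t + q = n then n - 1
  -- For `p ≥ n - 3` a braid has turned `n-2, n-3, n-2` into `n-3, n-2, n-3`, and for `p = n - 2`
  -- its first letter has also passed the initial `n-1`. The case `q = p = n - 2` records the second
  -- braid.
  else if p + 2 = n then (if t = 0 then n - 3 else if q = p then n - 2 else n - t)
  else if p + 3 = n then (if t = 0 then n - 1 else if t = 1 then n - 3 else n - t)
  else if t + p + 1 < n then n - 1 - t
  else if t + p + 1 = n then n - 2
  else n - t

/-- The reduced word of `ₙw` whose ascents are at the positions `n - 2 - p` and `n - 1 - q`. -/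
def hookWord (n p q : ℕ) : List ℕ := (List.range (n + 1)).map (letter n p q)

/-- The ascents make the parameters readable from the word. -/
theorem letter_lt_letter_succ_iff {n p q t : ℕ} (hn : 4 ≤ n) (hq : q ≤ p) (hp : p + 2 ≤ n)
    (ht : t < n) : letter n p q t < letter n p q (t + 1) ↔ t + p + 2 = n ∨ t + q + 1 = n := by
  unfold letter
  split_ifs <;> grind

theorem hookWord_injective {n p q p' q' : ℕ} (hn : 4 ≤ n) (hq : q ≤ p) (hp : p + 2 ≤ n)
    (hq' : q' ≤ p') (hp' : p' + 2 ≤ n) (h : hookWord n p q = hookWord n p' q') :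
    p = p' ∧ q = q' := by
  have hl : ∀ t, t ≤ n → letter n p q t = letter n p' q' t := by
    intro t ht
    have := congrArg (fun l : List ℕ => l[t]?) h
    simpa [hookWord, Nat.lt_succ_iff, ht] using this
  have key : ∀ t, t < n → (t + p + 2 = n ∨ t + q + 1 = n ↔ t + p' + 2 = n ∨ t + q' + 1 = n) := by
    intro t ht
    rw [← letter_lt_letter_succ_iff hn hq hp ht, ← letter_lt_letter_succ_iff hn hq' hp' ht,
      hl t ht.le, hl (t + 1) ht]
  -- Since `q ≤ p`, the ascent `n - 2 - p` is the smaller one, so equal ascent sets force equal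
  -- parameters.
  have h1 := key (n - 2 - p) (by omega)
  have h2 := key (n - 1 - q) (by omega)
  have h3 := key (n - 2 - p') (by omega)
  have h4 := key (n - 1 - q') (by omega)
  omega

theorem eq_map_range {N : ℕ} {f : ℕ → ℕ} {l : List ℕ} (h1 : l.length = N)
    (h : ∀ t, t < N → l.getD t 0 = f t) : l = (List.range N).map f := by
  refine List.ext_getElem (by simpa using h1) fun t ht ht' => ?_
  have := h t (h1 ▸ ht)
  rw [List.getD_eq_getElem _ _ ht] at this
  simpa using this

/-! ### Moves in terms of positions, and their effect on the parameters. -/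

/-- Exchanging the entries at positions `t` and `t + 1`. -/
def exchangeAt (f : ℕ → ℕ) (t s : ℕ) : ℕ :=
  if s = t then f (t + 1) else if s = t + 1 then f t else f s

/-- Replacing the entries `x, y, x` at positions `t, t + 1, t + 2` by `y, x, y`. -/
def braidAt (f : ℕ → ℕ) (t s : ℕ) : ℕ :=
  if s = t then f (t + 1) else if s = t + 1 then f t else if s = t + 2 then f (t + 1) else f s

/-- Application of a commutation or a braid relation, in either direction, at position `t` to the
word with the letters `f 0, f 1, …, f (N - 1)`, giving the letters `g 0, g 1, …, g (N - 1)`. -/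
def PositionMove (N : ℕ) (f g : ℕ → ℕ) : Prop :=
  ∃ t, (t + 1 < N ∧ (f t + 1 < f (t + 1) ∨ f (t + 1) + 1 < f t) ∧
      ∀ s < N, g s = exchangeAt f t s) ∨
    (t + 2 < N ∧ f (t + 2) = f t ∧ (f (t + 1) = f t + 1 ∨ f t = f (t + 1) + 1) ∧
      ∀ s < N, g s = braidAt f t s)

theorem exchangeAt_congr {f g : ℕ → ℕ} {N t : ℕ} (h : ∀ s < N, g s = exchangeAt f t s)
    (ht : t + 1 < N) : ∀ s < N, f s = exchangeAt g t s := by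
  intro s hs
  have e1 := h t (by omega)
  have e2 := h (t + 1) ht
  have e3 := h s hs
  clear h
  grind [exchangeAt]

theorem braidAt_congr {f g : ℕ → ℕ} {N t : ℕ} (h : ∀ s < N, g s = braidAt f t s)
    (h2 : f (t + 2) = f t) (ht : t + 2 < N) : ∀ s < N, f s = braidAt g t s := by
  intro s hs
  have e1 := h t (by omega)
  have e2 := h (t + 1) (by omega)
  have e3 := h (t + 2) ht
  have e4 := h s hs
  clear h
  grind [braidAt]

theorem PositionMove.symm {N : ℕ} {f g : ℕ → ℕ} (h : PositionMove N f g) : PositionMove N g f := by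
  obtain ⟨t, ⟨ht, hc, hg⟩ | ⟨ht, h2, hc, hg⟩⟩ := h
  · have e1 := hg t (by omega)
    have e2 := hg (t + 1) ht
    simp [exchangeAt] at e1 e2
    exact ⟨t, .inl ⟨ht, by omega, exchangeAt_congr hg ht⟩⟩
  · have e1 := hg t (by omega)
    have e2 := hg (t + 1) (by omega)
    have e3 := hg (t + 2) ht
    simp [braidAt] at e1 e2 e3
    exact ⟨t, .inr ⟨ht, by omega, by omega, braidAt_congr hg h2 ht⟩⟩

/-- Here the travelling `n-2` passes the letter `p + 1 ≤ n - 4`. The next lemmas treat the remaining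
steps: the braid, the exchange of `n-1` and `n-3` at the front, and the two kinds of move of the
travelling `n-1`. -/
theorem letter_succ_left_of_add_five_le {n p q s t : ℕ} (hq : q ≤ p) (hp : p + 5 ≤ n)
    (ht : t + p + 2 = n) (hs : s < n + 1) :
    letter n (p + 1) q s = exchangeAt (letter n p q) t s := by
  grind (splits := 40) [exchangeAt, letter]

theorem letter_succ_left_of_add_four_eq {n p q s : ℕ} (hq : q ≤ p) (hp : p + 4 = n)
    (hs : s < n + 1) :
    letter n (p + 1) q s = braidAt (letter n p q) 1 s := by
  grind (splits := 40) [braidAt, letter]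

theorem letter_succ_left_of_add_three_eq {n p q s : ℕ} (hq : q ≤ p) (hp : p + 3 = n)
    (hs : s < n + 1) :
    letter n (p + 1) q s = exchangeAt (letter n p q) 0 s := by
  grind (splits := 40) [exchangeAt, letter]

theorem letter_succ_right_of_add_four_le {n p q s t : ℕ} (hq : q < p)
    (hq' : q + 4 ≤ n) (ht : t + q + 1 = n) (hs : s < n + 1) :
    letter n p (q + 1) s = exchangeAt (letter n p q) t s := by
  grind (splits := 40) [exchangeAt, letter]

theorem letter_succ_right_of_add_three_eq {n p q s : ℕ} (hn : 4 ≤ n) (hq : q < p) (hp : p + 2 ≤ n)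
    (hq' : q + 3 = n) (hs : s < n + 1) :
    letter n p (q + 1) s = braidAt (letter n p q) 1 s := by
  grind (splits := 40) [braidAt, letter]

/-- The positions at which two neighbouring letters of the words of `ₙw` commute. -/
theorem commuting_position {n p q t : ℕ} (hn : 4 ≤ n) (hq : q ≤ p) (hp : p + 2 ≤ n) (ht : t < n)
    (h : letter n p q t + 1 < letter n p q (t + 1) ∨ letter n p q (t + 1) + 1 < letter n p q t) :
    (p + 5 ≤ n ∧ t + p + 2 = n) ∨ (p + 4 ≤ n ∧ q < p ∧ t + p + 1 = n) ∨ (p + 3 = n ∧ t = 0) ∨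
      (p + 2 = n ∧ q < p ∧ t = 0) ∨ (q < p ∧ q + 4 ≤ n ∧ t + q + 1 = n) ∨
      (1 ≤ q ∧ q + 3 ≤ n ∧ t + q = n) := by
  grind (splits := 40) [letter]

/-- The positions at which a braid relation applies to the words of `ₙw`. -/
theorem braid_position {n p q t : ℕ} (hn : 4 ≤ n) (hq : q ≤ p) (hp : p + 2 ≤ n) (ht : t + 1 < n)
    (h : letter n p q (t + 2) = letter n p q t)
    (h' : letter n p q (t + 1) = letter n p q t + 1 ∨ letter n p q t = letter n p q (t + 1) + 1) :
    t = 1 ∧ (p + 4 = n ∨ (p + 3 = n ∧ q < p) ∨ (p + 2 = n ∧ q + 3 = n) ∨ q + 2 = n) := by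
  grind (splits := 40) [letter]

theorem map_range_add_two (f : ℕ → ℕ) (t r : ℕ) : (List.range (t + 2 + r)).map f =
    (List.range t).map f ++ [f t, f (t + 1)] ++ (List.range r).map fun s => f (t + 2 + s) := by
  simp [List.range_add, List.range_succ, Function.comp_def]

theorem map_range_add_three (f : ℕ → ℕ) (t r : ℕ) : (List.range (t + 3 + r)).map f =
    (List.range t).map f ++ [f t, f (t + 1), f (t + 2)] ++
      (List.range r).map fun s => f (t + 3 + s) := by
  simp [List.range_add, List.range_succ, Function.comp_def]

theorem PositionMove.wordMove {N : ℕ} {f g : ℕ → ℕ} (h : PositionMove N f g) :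
    WordMove ((List.range N).map f) ((List.range N).map g) ∨
      WordMove ((List.range N).map g) ((List.range N).map f) := by
  obtain ⟨t, ⟨ht, hc, hg⟩ | ⟨ht, h2, hc, hg⟩⟩ := h
  · obtain ⟨r, rfl⟩ : ∃ r, N = t + 2 + r := ⟨N - (t + 2), by omega⟩
    have e1 : g t = f (t + 1) := by rw [hg t (by omega)]; simp [exchangeAt]
    have e2 : g (t + 1) = f t := by rw [hg (t + 1) (by omega)]; simp [exchangeAt]
    have e3 : (List.range t).map g = (List.range t).map f := List.map_congr_left fun s hs => by
      rw [List.mem_range] at hs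
      rw [hg s (by omega), exchangeAt, if_neg (by omega), if_neg (by omega)]
    have e4 : ((List.range r).map fun s => g (t + 2 + s)) =
        (List.range r).map fun s => f (t + 2 + s) := List.map_congr_left fun s hs => by
      rw [List.mem_range] at hs
      rw [hg _ (by omega), exchangeAt, if_neg (by omega), if_neg (by omega)]
    rw [map_range_add_two, map_range_add_two, e1, e2, e3, e4]
    exact .inl (.commutation _ _ _ _ hc)
  · obtain ⟨r, rfl⟩ : ∃ r, N = t + 3 + r := ⟨N - (t + 3), by omega⟩
    have e1 : g t = f (t + 1) := by rw [hg t (by omega)]; simp [braidAt]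
    have e2 : g (t + 1) = f t := by rw [hg (t + 1) (by omega)]; simp [braidAt]
    have e5 : g (t + 2) = f (t + 1) := by rw [hg (t + 2) (by omega)]; simp [braidAt]
    have e3 : (List.range t).map g = (List.range t).map f := List.map_congr_left fun s hs => by
      rw [List.mem_range] at hs
      rw [hg s (by omega), braidAt, if_neg (by omega), if_neg (by omega), if_neg (by omega)]
    have e4 : ((List.range r).map fun s => g (t + 3 + s)) =
        (List.range r).map fun s => f (t + 3 + s) := List.map_congr_left fun s hs => by
      rw [List.mem_range] at hs
      rw [hg _ (by omega), braidAt, if_neg (by omega), if_neg (by omega), if_neg (by omega)]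
    rw [map_range_add_three, map_range_add_three, e1, e2, e3, e4, e5, h2]
    -- `WordMove.braid` is directed, so the larger of the two letters decides which disjunct holds.
    rcases hc with hc | hc <;> rw [hc]
    · exact .inl (.braid _ _ _)
    · exact .inr (.braid _ _ _)

theorem getD_append_pair (u v : List ℕ) (x y s : ℕ) : (u ++ [x, y] ++ v).getD s 0 =
    if s = u.length then x else if s = u.length + 1 then y
    else if s < u.length then u.getD s 0 else v.getD (s - u.length - 2) 0 := by
  simp only [List.getD_eq_getElem?_getD, List.append_assoc, List.getElem?_append]
  by_cases h : s < u.length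
  · simp [h, h.ne, show s ≠ u.length + 1 by omega]
  · obtain ⟨r, rfl⟩ := Nat.exists_eq_add_of_le (not_lt.1 h)
    rcases r with _ | _ | r <;> simp

theorem getD_append_triple (u v : List ℕ) (x y z s : ℕ) : (u ++ [x, y, z] ++ v).getD s 0 =
    if s = u.length then x else if s = u.length + 1 then y else if s = u.length + 2 then z
    else if s < u.length then u.getD s 0 else v.getD (s - u.length - 3) 0 := by
  simp only [List.getD_eq_getElem?_getD, List.append_assoc, List.getElem?_append]
  by_cases h : s < u.length
  · simp [h, h.ne, show s ≠ u.length + 1 by omega, show s ≠ u.length + 2 by omega]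
  · obtain ⟨r, rfl⟩ := Nat.exists_eq_add_of_le (not_lt.1 h)
    rcases r with _ | _ | _ | r
    · simp
    · simp
    · simp
    · simp [show ¬r + 1 + 1 + 1 < 3 by omega]

theorem WordMove.positionMove {a b : List ℕ} (h : WordMove a b) :
    a.length = b.length ∧ PositionMove a.length (fun s => a.getD s 0) (fun s => b.getD s 0) := by
  cases h with
  | commutation u v i j h =>
    refine ⟨by simp, u.length, .inl ⟨by simp, ?_, fun s _ => ?_⟩⟩
    · simp only [getD_append_pair]
      simpa using h
    · simp only [exchangeAt, getD_append_pair]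
      split_ifs <;> first | rfl | omega
  | braid u v i =>
    refine ⟨by simp, u.length, .inr ⟨by simp, ?_, ?_, fun s _ => ?_⟩⟩
    · simp only [getD_append_triple]
      simp
    · simp only [getD_append_triple]
      simp
    · simp only [braidAt, getD_append_triple]
      split_ifs <;> first | rfl | omega

theorem exists_eq_map_range_of_wordMove {N : ℕ} {f : ℕ → ℕ} {b : List ℕ}
    (h : WordMove ((List.range N).map f) b ∨ WordMove b ((List.range N).map f)) :
    ∃ g, b = (List.range N).map g ∧ PositionMove N f g := by
  have key : ((List.range N).map f).length = b.length ∧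
      PositionMove ((List.range N).map f).length (fun s => ((List.range N).map f).getD s 0)
        (fun s => b.getD s 0) := by
    rcases h with h | h
    · exact h.positionMove
    · obtain ⟨h1, h2⟩ := h.positionMove
      exact ⟨h1.symm, h1 ▸ h2.symm⟩
  rw [List.length_map, List.length_range] at key
  obtain ⟨hl, hm⟩ := key
  have hf : ∀ s < N, ((List.range N).map f).getD s 0 = f s := by
    intro s hs
    simp [List.getD_eq_getElem?_getD, hs]
  -- Only positions below `N`, the length of `b`, matter, so the default `0` is harmless.
  refine ⟨fun s => b.getD s 0, eq_map_range hl.symm fun _ _ => rfl, ?_⟩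
  obtain ⟨t, ⟨ht, hc, hg⟩ | ⟨ht, h2, hc, hg⟩⟩ := hm
  · refine ⟨t, .inl ⟨ht, ?_, fun s hs => ?_⟩⟩
    · dsimp only at hc
      rwa [hf t (by omega), hf (t + 1) ht] at hc
    · rw [hg s hs, exchangeAt, exchangeAt, hf t (by omega), hf (t + 1) ht, hf s hs]
  · refine ⟨t, .inr ⟨ht, ?_, ?_, fun s hs => ?_⟩⟩
    · dsimp only at h2 hc
      rwa [hf t (by omega), hf (t + 2) ht] at h2
    · dsimp only at h2 hc
      rwa [hf t (by omega), hf (t + 1) (by omega)] at hc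
    · rw [hg s hs, braidAt, braidAt, hf t (by omega), hf (t + 1) (by omega), hf s hs]

/-- A move away from the word with parameters `(p, q)` leads to a word whose parameters differ by
a unit step. -/
theorem exists_letter_of_positionMove {n p q : ℕ} {g : ℕ → ℕ} (hn : 4 ≤ n) (hq : q ≤ p)
    (hp : p + 2 ≤ n) (h : PositionMove (n + 1) (letter n p q) g) :
    ∃ b : ℕ × ℕ, (b.2 ≤ b.1 ∧ b.1 + 2 ≤ n) ∧ (UnitStep (p, q) b ∨ UnitStep b (p, q)) ∧
      ∀ s < n + 1, g s = letter n b.1 b.2 s := by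
  have up : ∀ {p q : ℕ}, UnitStep (p, q) (p + 1, q) := .inl ⟨rfl, rfl⟩
  have up' : ∀ {p q : ℕ}, UnitStep (p, q) (p, q + 1) := .inr ⟨rfl, rfl⟩
  obtain ⟨t, ⟨ht, hc, hg⟩ | ⟨ht, h2, hc, hg⟩⟩ := h
  · rcases commuting_position hn hq hp (by omega) hc with
      ⟨h1, h2⟩ | ⟨h1, h2, h3⟩ | ⟨h1, rfl⟩ | ⟨h1, h2, rfl⟩ | ⟨h1, h2, h3⟩ | ⟨h1, h2, h3⟩
    · exact ⟨(p + 1, q), ⟨by dsimp only; omega, by dsimp only; omega⟩, .inl up, fun s hs => by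
        rw [hg s hs, letter_succ_left_of_add_five_le hq h1 h2 hs]⟩
    · obtain ⟨p, rfl⟩ : ∃ r, p = r + 1 := ⟨p - 1, by omega⟩
      refine ⟨(p, q), ⟨by dsimp only; omega, by dsimp only; omega⟩, .inr up, fun s hs => ?_⟩
      rw [hg s hs]
      exact (exchangeAt_congr (fun s hs => letter_succ_left_of_add_five_le (by omega) (by omega)
        (by omega) hs) ht s hs).symm
    · exact ⟨(p + 1, q), ⟨by dsimp only; omega, by dsimp only; omega⟩, .inl up, fun s hs => by
        rw [hg s hs, letter_succ_left_of_add_three_eq hq h1 hs]⟩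
    · obtain ⟨p, rfl⟩ : ∃ r, p = r + 1 := ⟨p - 1, by omega⟩
      refine ⟨(p, q), ⟨by dsimp only; omega, by dsimp only; omega⟩, .inr up, fun s hs => ?_⟩
      rw [hg s hs]
      exact (exchangeAt_congr (fun s hs => letter_succ_left_of_add_three_eq (by omega) (by omega)
        hs) ht s hs).symm
    · exact ⟨(p, q + 1), ⟨by dsimp only; omega, by dsimp only; omega⟩, .inl up', fun s hs => by
        rw [hg s hs, letter_succ_right_of_add_four_le h1 h2 h3 hs]⟩
    · obtain ⟨q, rfl⟩ : ∃ r, q = r + 1 := ⟨q - 1, by omega⟩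
      refine ⟨(p, q), ⟨by dsimp only; omega, by dsimp only; omega⟩, .inr up', fun s hs => ?_⟩
      rw [hg s hs]
      exact (exchangeAt_congr (fun s hs => letter_succ_right_of_add_four_le (by omega)
        (by omega) (by omega) hs) ht s hs).symm
  · obtain ⟨rfl, h1 | ⟨h1, h3⟩ | ⟨h1, h3⟩ | h1⟩ := braid_position hn hq hp (by omega) h2 hc
    · exact ⟨(p + 1, q), ⟨by dsimp only; omega, by dsimp only; omega⟩, .inl up, fun s hs => by
        rw [hg s hs, letter_succ_left_of_add_four_eq hq h1 hs]⟩
    · obtain ⟨p, rfl⟩ : ∃ r, p = r + 1 := ⟨p - 1, by omega⟩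
      refine ⟨(p, q), ⟨by dsimp only; omega, by dsimp only; omega⟩, .inr up, fun s hs => ?_⟩
      rw [hg s hs]
      exact (braidAt_congr (fun s hs => letter_succ_left_of_add_four_eq (by omega) (by omega) hs)
        (by grind (splits := 40) [letter]) ht s hs).symm
    · exact ⟨(p, q + 1), ⟨by dsimp only; omega, by dsimp only; omega⟩, .inl up', fun s hs => by
        rw [hg s hs, letter_succ_right_of_add_three_eq hn (by omega) hp h3 hs]⟩
    · obtain ⟨q, rfl⟩ : ∃ r, q = r + 1 := ⟨q - 1, by omega⟩
      refine ⟨(p, q), ⟨by dsimp only; omega, by dsimp only; omega⟩, .inr up', fun s hs => ?_⟩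
      rw [hg s hs]
      exact (braidAt_congr (fun s hs => letter_succ_right_of_add_three_eq hn (by omega) hp
        (by omega) hs) (by grind (splits := 40) [letter]) ht s hs).symm

theorem positionMove_letter_of_unitStep {n : ℕ} {a b : ℕ × ℕ} (hn : 4 ≤ n)
    (ha : a.2 ≤ a.1 ∧ a.1 + 2 ≤ n) (hb : b.2 ≤ b.1 ∧ b.1 + 2 ≤ n) (h : UnitStep a b) :
    PositionMove (n + 1) (letter n a.1 a.2) (letter n b.1 b.2) := by
  obtain ⟨p, q⟩ := a
  obtain ⟨p', q'⟩ := b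
  dsimp only at *
  rcases h with ⟨h1, h2⟩ | ⟨h1, h2⟩ <;> dsimp only at h1 h2 <;> subst h1 h2
  · obtain h | h | h : p + 5 ≤ n ∨ p + 4 = n ∨ p + 3 = n := by omega
    · refine ⟨n - 2 - p, .inl ⟨by omega, ?_, fun s hs =>
        letter_succ_left_of_add_five_le ha.1 h (by omega) hs⟩⟩
      grind (splits := 40) [letter]
    · refine ⟨1, .inr ⟨by omega, ?_, ?_, fun s hs =>
        letter_succ_left_of_add_four_eq ha.1 h hs⟩⟩ <;>
      grind (splits := 40) [letter]
    · refine ⟨0, .inl ⟨by omega, ?_, fun s hs =>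
        letter_succ_left_of_add_three_eq ha.1 h hs⟩⟩
      grind (splits := 40) [letter]
  · obtain h | h : q + 4 ≤ n ∨ q + 3 = n := by omega
    · refine ⟨n - 1 - q, .inl ⟨by omega, ?_, fun s hs =>
        letter_succ_right_of_add_four_le hb.1 h (by omega) hs⟩⟩
      grind (splits := 40) [letter]
    · refine ⟨1, .inr ⟨by omega, ?_, ?_, fun s hs =>
        letter_succ_right_of_add_three_eq hn hb.1 ha.2 h hs⟩⟩ <;>
      grind (splits := 40) [letter]

/-! ### The initial word is reduced. -/

theorem prod_descending_val {n : ℕ} (m : ℕ) (hm : m < n) (x : Fin n) :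
    (((List.range m).map fun t => simpleTransposition n (m - t)).prod x).1 =
      if x.1 = 0 then m else if x.1 ≤ m then x.1 - 1 else x.1 := by
  induction m with
  | zero =>
    rw [List.range_zero, List.map_nil, List.prod_nil, Equiv.Perm.one_apply]
    split_ifs <;> omega
  | succ m ih =>
    have e : ((List.range m).map fun t => simpleTransposition n (m + 1 - (t + 1))) =
        (List.range m).map fun t => simpleTransposition n (m - t) :=
      List.map_congr_left fun t _ => by rw [Nat.add_sub_add_right]
    rw [List.range_succ_eq_map, List.map_cons, List.map_map, List.prod_cons, Function.comp_def,
      Nat.sub_zero, e, Equiv.Perm.mul_apply, simpleTransposition_val (by omega) hm,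
      ih (by omega)]
    split_ifs <;> omega

theorem prod_hookWord_zero {n : ℕ} (hn : 4 ≤ n) :
    ((hookWord n 0 0).map (simpleTransposition n)).prod = hookPerm n hn := by
  obtain ⟨m, rfl⟩ := Nat.exists_eq_add_of_le' hn
  have e : ((List.range (m + 3)).map fun t => simpleTransposition (m + 4) (letter (m + 4) 0 0 t)) =
      (List.range (m + 3)).map fun t => simpleTransposition (m + 4) (m + 3 - t) :=
    List.map_congr_left fun t ht => by
      rw [List.mem_range] at ht
      congr 1
      unfold letter
      split_ifs <;> omega
  have e1 : letter (m + 4) 0 0 (m + 3) = m + 2 := by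
    unfold letter
    split_ifs <;> omega
  have e2 : letter (m + 4) 0 0 (m + 4) = m + 3 := by
    unfold letter
    split_ifs <;> omega
  rw [hookWord, List.map_map, Function.comp_def, List.range_succ, List.range_succ,
    List.map_append, List.map_append, List.prod_append, List.prod_append, e]
  simp only [List.map_cons, List.map_nil, List.prod_singleton, e1, e2]
  ext x
  rw [Equiv.Perm.mul_apply, Equiv.Perm.mul_apply, prod_descending_val (m + 3) (by omega),
    simpleTransposition_val (by omega) (by omega), simpleTransposition_val (by omega) (by omega)]
  simp only [hookPerm, Equiv.ofBijective_apply, hookFun]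
  have := x.2
  split_ifs <;> first | omega | rfl | contradiction

/-- The first entry exceeds the `n - 1` others, and the last is smaller than the two before it. The
matching upper bound comes from the initial word through `length_prod_le`. -/
theorem le_length_hookPerm {n : ℕ} (hn : 4 ≤ n) : n + 1 ≤ length (hookPerm n hn) := by
  obtain ⟨m, rfl⟩ := Nat.exists_eq_add_of_le' hn
  let g : ℕ → Fin (m + 4) × Fin (m + 4) := fun t =>
    if h : t < m + 3 then (⟨0, by omega⟩, ⟨t + 1, by omega⟩)
    else if t = m + 3 then (⟨m + 1, by omega⟩, ⟨m + 3, by omega⟩)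
    else (⟨m + 2, by omega⟩, ⟨m + 3, by omega⟩)
  have hg : ∀ t, ((g t).1.1 = if t < m + 3 then 0 else if t = m + 3 then m + 1 else m + 2) ∧
      ((g t).2.1 = if t < m + 3 then t + 1 else m + 3) := by
    intro t
    dsimp only [g]
    split_ifs <;> exact ⟨rfl, rfl⟩
  rw [← Finset.card_range (m + 4 + 1)]
  refine Finset.card_le_card_of_injOn g ?_ ?_
  · intro t ht
    obtain ⟨h1, h2⟩ := hg t
    simp only [Finset.coe_filter, Finset.mem_univ, true_and, Set.mem_ofPred_eq, Fin.lt_def,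
      hookPerm, Equiv.ofBijective_apply, hookFun]
    split_ifs at * <;> first | omega | (dsimp only; omega)
  · intro s hs t ht hst
    simp only [Finset.coe_range, Set.mem_Iio] at hs ht
    obtain ⟨h1, h2⟩ := hg t
    obtain ⟨h3, h4⟩ := hg s
    rw [hst] at h3 h4
    split_ifs at * <;> omega

theorem letter_mem {n p q t : ℕ} (hn : 4 ≤ n) (hq : q ≤ p) (hp : p + 2 ≤ n) (ht : t < n + 1) :
    1 ≤ letter n p q t ∧ letter n p q t < n := by
  grind (splits := 40) [letter]

theorem isReducedWord_hookWord_zero {n : ℕ} (hn : 4 ≤ n) :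
    IsReducedWord (hookPerm n hn) (hookWord n 0 0) := by
  have h1 : ∀ i ∈ hookWord n 0 0, 1 ≤ i ∧ i < n := by
    intro i hi
    simp only [hookWord, List.mem_map, List.mem_range] at hi
    obtain ⟨t, ht, rfl⟩ := hi
    exact letter_mem hn le_rfl (by omega) ht
  have h2 := length_prod_le _ h1
  rw [prod_hookWord_zero hn] at h2
  have h3 := le_length_hookPerm hn
  have h4 : (hookWord n 0 0).length = n + 1 := by simp [hookWord]
  exact ⟨h1, prod_hookWord_zero hn, by omega⟩

/-! ### The graph of reduced words as a staircase. -/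

theorem wordMove_hookWord_of_unitStep {n : ℕ} {a b : ℕ × ℕ} (hn : 4 ≤ n)
    (ha : a.2 ≤ a.1 ∧ a.1 + 2 ≤ n) (hb : b.2 ≤ b.1 ∧ b.1 + 2 ≤ n) (h : UnitStep a b) :
    WordMove (hookWord n a.1 a.2) (hookWord n b.1 b.2) ∨
      WordMove (hookWord n b.1 b.2) (hookWord n a.1 a.2) :=
  (positionMove_letter_of_unitStep hn ha hb h).wordMove

theorem exists_hookWord_of_wordMove {n : ℕ} {a : ℕ × ℕ} {w : List ℕ} (hn : 4 ≤ n)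
    (ha : a.2 ≤ a.1 ∧ a.1 + 2 ≤ n)
    (h : WordMove (hookWord n a.1 a.2) w ∨ WordMove w (hookWord n a.1 a.2)) :
    ∃ b : ℕ × ℕ, (b.2 ≤ b.1 ∧ b.1 + 2 ≤ n) ∧ (UnitStep a b ∨ UnitStep b a) ∧
      w = hookWord n b.1 b.2 := by
  obtain ⟨g, rfl, hg⟩ := exists_eq_map_range_of_wordMove h
  obtain ⟨b, hb, hab, hs⟩ := exists_letter_of_positionMove hn ha.1 ha.2 hg
  exact ⟨b, hb, hab, List.map_congr_left fun s hs' => hs s (List.mem_range.1 hs')⟩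

theorem isReducedWord_hookWord {n : ℕ} (hn : 4 ≤ n) (a : Staircase (n - 2)) :
    IsReducedWord (hookPerm n hn) (hookWord n a.1.1 a.1.2) := by
  have h0 : (⟨(0, 0), le_rfl, Nat.zero_le _⟩ : Staircase (n - 2)) ≤ a :=
    Staircase.le_iff.2 ⟨Nat.zero_le _, Nat.zero_le _⟩
  have h := Staircase.reflTransGen_of_le h0
  induction h with
  | refl => exact isReducedWord_hookWord_zero hn
  | @tail b c hb hbc ih =>
    have ih := ih (Staircase.le_iff.2 ⟨Nat.zero_le _, Nat.zero_le _⟩)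
    have hb' := b.2
    have hc' := c.2
    rcases wordMove_hookWord_of_unitStep hn ⟨hb'.1, by omega⟩ ⟨hc'.1, by omega⟩ hbc with h | h
    · exact h.isReducedWord_iff.1 ih
    · exact h.isReducedWord_iff.2 ih

theorem exists_hookWord_of_isReducedWord {n : ℕ} (hn : 4 ≤ n) {w : List ℕ}
    (hw : IsReducedWord (hookPerm n hn) w) :
    ∃ b : ℕ × ℕ, (b.2 ≤ b.1 ∧ b.1 + 2 ≤ n) ∧ w = hookWord n b.1 b.2 := by
  -- Belonging to the family is invariant under moves in both directions, hence along Matsumoto's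
  -- equivalence.
  have key : ∀ u v, Relation.EqvGen WordMove u v →
      ((∃ b : ℕ × ℕ, (b.2 ≤ b.1 ∧ b.1 + 2 ≤ n) ∧ u = hookWord n b.1 b.2) ↔
        ∃ b : ℕ × ℕ, (b.2 ≤ b.1 ∧ b.1 + 2 ≤ n) ∧ v = hookWord n b.1 b.2) := by
    intro u v h
    induction h with
    | rel u v h =>
      constructor
      · rintro ⟨a, ha, rfl⟩
        obtain ⟨b, hb, -, e⟩ := exists_hookWord_of_wordMove hn ha (.inl h)
        exact ⟨b, hb, e⟩
      · rintro ⟨a, ha, rfl⟩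
        obtain ⟨b, hb, -, e⟩ := exists_hookWord_of_wordMove hn ha (.inr h)
        exact ⟨b, hb, e⟩
    | refl => rfl
    | symm _ _ _ ih => exact ih.symm
    | trans _ _ _ _ _ ih₁ ih₂ => exact ih₁.trans ih₂
  exact (key _ _ ((isReducedWord_hookWord_zero hn).eqvGen_wordMove hw)).1
    ⟨(0, 0), ⟨le_rfl, by dsimp only; omega⟩, rfl⟩

/-- The reduced words of `ₙw`, parametrized by the positions of their two ascents. -/
noncomputable def staircaseEquivReducedWord {n : ℕ} (hn : 4 ≤ n) :
    Staircase (n - 2) ≃ {a : List ℕ // IsReducedWord (hookPerm n hn) a} :=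
  Equiv.ofBijective (fun a => ⟨hookWord n a.1.1 a.1.2, isReducedWord_hookWord hn a⟩) <| by
    constructor
    · intro a b h
      have ha := a.2
      have hb := b.2
      obtain ⟨h1, h2⟩ := hookWord_injective hn ha.1 (by omega) hb.1 (by omega)
        (congrArg Subtype.val h)
      exact Subtype.ext (Prod.ext h1 h2)
    · rintro ⟨w, hw⟩
      obtain ⟨b, hb, rfl⟩ := exists_hookWord_of_isReducedWord hn hw
      exact ⟨⟨b, hb.1, by omega⟩, rfl⟩

/-- The graph of reduced words of `ₙw` is the Hasse diagram of the staircase. -/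
noncomputable def hasseStaircaseIso {n : ℕ} (hn : 4 ≤ n) :
    SimpleGraph.hasse (Staircase (n - 2)) ≃g reducedWordGraph (hookPerm n hn) where
  toEquiv := staircaseEquivReducedWord hn
  map_rel_iff' := by
    intro a b
    have ha := a.2
    have hb := b.2
    have ha' : a.1.2 ≤ a.1.1 ∧ a.1.1 + 2 ≤ n := ⟨ha.1, by omega⟩
    have hb' : b.1.2 ≤ b.1.1 ∧ b.1.1 + 2 ≤ n := ⟨hb.1, by omega⟩
    rw [SimpleGraph.hasse_adj, Staircase.covBy_iff, Staircase.covBy_iff, reducedWordGraph,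
      SimpleGraph.fromRel_adj, Ne, (staircaseEquivReducedWord hn).apply_eq_iff_eq]
    change ¬a = b ∧ (WordMove (hookWord n a.1.1 a.1.2) (hookWord n b.1.1 b.1.2) ∨
      WordMove (hookWord n b.1.1 b.1.2) (hookWord n a.1.1 a.1.2)) ↔ _
    constructor
    · rintro ⟨-, h⟩
      obtain ⟨c, hc, hac, e⟩ := exists_hookWord_of_wordMove hn ha' h
      obtain ⟨h1, h2⟩ := hookWord_injective hn hb'.1 hb'.2 hc.1 hc.2 e
      rwa [Prod.ext h1 h2]
    · intro h
      refine ⟨?_, ?_⟩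
      · rintro rfl
        simp [UnitStep] at h
      · rcases h with h | h
        · exact wordMove_hookWord_of_unitStep hn ha' hb' h
        · exact (wordMove_hookWord_of_unitStep hn hb' ha' h).symm

/-! ### Recording tableaux. -/

/-- The complement of `{q, p + 1}`, listed increasingly. -/
def complementFun (p q i : ℕ) : ℕ := if i < q then i else if i < p then i + 1 else i + 2

/-- The tableau with the entries `q` and `p + 1` (counted from `0`) below the first row. -/
def tableauOfStaircase {n : ℕ} (hn : 2 ≤ n) (a : Staircase (n - 2)) : RecordingTableau n where
  row i := ⟨complementFun a.1.1 a.1.2 i, by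
    have := i.2
    unfold complementFun
    split_ifs <;> omega⟩
  mid := ⟨a.1.1 + 1, by have := a.2; omega⟩
  bot := ⟨a.1.2, by have := a.2; omega⟩
  row_strictMono i j h := by
    rw [Fin.lt_def] at h ⊢
    dsimp only [complementFun]
    split_ifs <;> omega
  row_ne_mid i := by
    have := a.2
    rw [Ne, Fin.ext_iff]
    dsimp only [complementFun]
    split_ifs <;> omega
  row_ne_bot i := by
    have := a.2
    rw [Ne, Fin.ext_iff]
    dsimp only [complementFun]
    split_ifs <;> omega
  bot_lt_mid := by
    have := a.2
    rw [Fin.lt_def]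
    dsimp only
    omega

theorem RecordingTableau.range_row {n : ℕ} (t : RecordingTableau n) :
    Set.range t.row = {t.mid, t.bot}ᶜ := by
  have h : Finset.univ.image t.row = ({t.mid, t.bot} : Finset (Fin n))ᶜ := by
    refine Finset.eq_of_subset_of_card_le ?_ ?_
    · intro x hx
      simp only [Finset.mem_image, Finset.mem_univ, true_and] at hx
      obtain ⟨i, rfl⟩ := hx
      simp [t.row_ne_mid, t.row_ne_bot]
    · rw [Finset.card_compl, Finset.card_pair t.bot_lt_mid.ne',
        Finset.card_image_of_injective _ t.row_strictMono.injective]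
      simp
  have := congrArg (fun s : Finset (Fin n) => (s : Set (Fin n))) h
  rwa [Finset.coe_image, Finset.coe_univ, Set.image_univ, Finset.coe_compl, Finset.coe_pair] at this

theorem RecordingTableau.ext_of_mid_bot {n : ℕ} {s t : RecordingTableau n} (hm : s.mid = t.mid)
    (hb : s.bot = t.bot) : s = t := by
  refine RecordingTableau.ext ?_ hm hb
  rw [← StrictMono.range_inj s.row_strictMono t.row_strictMono, s.range_row, t.range_row, hm, hb]

/-- The recording tableaux of shape `(n - 2, 1, 1)` form a staircase. -/
def staircaseOrderIsoTableau {n : ℕ} (hn : 2 ≤ n) : Staircase (n - 2) ≃o RecordingTableau n where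
  toFun := tableauOfStaircase hn
  invFun t := ⟨(t.mid.1 - 1, t.bot.1), by
    have := t.bot_lt_mid
    rw [Fin.lt_def] at this
    dsimp only
    omega⟩
  left_inv a := rfl
  right_inv t := by
    have := t.bot_lt_mid
    rw [Fin.lt_def] at this
    refine RecordingTableau.ext_of_mid_bot (Fin.ext ?_) rfl
    change t.mid.1 - 1 + 1 = t.mid.1
    omega
  map_rel_iff' := by
    intro a b
    rw [Staircase.le_iff]
    change ((∀ i : Fin (n - 2), complementFun b.1.1 b.1.2 i ≤ complementFun a.1.1 a.1.2 i) ∧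
      a.1.1 + 1 ≤ b.1.1 + 1 ∧ a.1.2 ≤ b.1.2) ↔ _
    constructor
    · intro h
      omega
    · intro h
      -- The first-row inequalities are automatic: `complementFun` decreases weakly when `p` or `q`
      -- grows.
      refine ⟨fun i => ?_, by omega, h.2⟩
      have := a.2
      have := b.2
      unfold complementFun
      split_ifs <;> omega

/-! ### Row readings and the Bruhat order. -/

theorem RecordingTableau.reading_injective {n : ℕ} :
    Function.Injective (RecordingTableau.reading : RecordingTableau n → _) := by
  intro s t h
  have hf : ∀ i, s.readingFun i = t.readingFun i := fun i => congrArg (fun w => w i) h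
  have hlt := s.bot_lt_mid
  rw [Fin.lt_def] at hlt
  refine RecordingTableau.ext_of_mid_bot ?_ ?_
  · simpa [readingFun] using hf ⟨1, by omega⟩
  · simpa [readingFun] using hf ⟨0, by omega⟩

theorem BruhatStep.apply_zero_le {n : ℕ} {v w : Equiv.Perm (Fin (n + 2))} (h : BruhatStep v w) :
    v 0 ≤ w 0 := by
  obtain ⟨i, j, hij, hv, rfl⟩ := h
  rw [Equiv.Perm.mul_apply, Equiv.swap_apply_def]
  split_ifs with h1 h2
  · rw [h1]
    exact hv.le
  · subst h2
    exact absurd hij (Fin.not_lt_zero _)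
  · exact le_rfl

theorem BruhatStep.max_apply_le {n : ℕ} {v w : Equiv.Perm (Fin (n + 2))} (h : BruhatStep v w) :
    max (v 0) (v 1) ≤ max (w 0) (w 1) := by
  obtain ⟨i, j, hij, hv, rfl⟩ := h
  have h01 : ∀ x : Fin (n + 2), x < 1 → x = 0 := fun x hx => by
    rw [Fin.lt_def, Fin.val_one] at hx
    exact Fin.ext (by rw [Fin.val_zero]; omega)
  rw [Equiv.Perm.mul_apply, Equiv.Perm.mul_apply, Equiv.swap_apply_def, Equiv.swap_apply_def]
  have hj : (0 : Fin (n + 2)) ≠ j := fun h => by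
    subst h
    exact absurd hij (Fin.not_lt_zero _)
  rw [if_neg hj]
  have hne : (1 : Fin (n + 2)) ≠ 0 := by simp
  by_cases hi0 : 0 = i
  · subst hi0
    rw [if_pos rfl, if_neg hne]
    split_ifs with h2
    · subst h2
      exact (max_comm _ _).le
    · exact max_le_max hv.le le_rfl
  · rw [if_neg hi0]
    split_ifs with h1 h2
    · subst h1
      exact max_le_max le_rfl hv.le
    · subst h2
      exact absurd (h01 i hij).symm hi0
    · exact le_rfl

/-- These two monotone quantities detect the order on readings. They are monotone on the whole
symmetric group, so a Bruhat chain between readings may pass through other permutations. -/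
theorem BruhatLE.apply_le {n : ℕ} {v w : Equiv.Perm (Fin (n + 2))} (h : BruhatLE v w) :
    v 0 ≤ w 0 ∧ max (v 0) (v 1) ≤ max (w 0) (w 1) := by
  induction h with
  | refl => exact ⟨le_rfl, le_rfl⟩
  | tail _ h ih => exact ⟨ih.1.trans h.apply_zero_le, ih.2.trans h.max_apply_le⟩

theorem reading_tableauOfStaircase_val {n : ℕ} (hn : 2 ≤ n) (a : Staircase (n - 2)) (i : Fin n) :
    ((tableauOfStaircase hn a).reading i).1 = if i.1 = 0 then a.1.2 else if i.1 < 2 then a.1.1 + 1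
      else complementFun a.1.1 a.1.2 (i.1 - 2) := by
  change ((tableauOfStaircase hn a).readingFun i).1 = _
  unfold RecordingTableau.readingFun
  split_ifs <;> rfl

theorem swap_val {n : ℕ} (i j x : Fin n) :
    (Equiv.swap i j x).1 = if x.1 = i.1 then j.1 else if x.1 = j.1 then i.1 else x.1 := by
  rw [Equiv.swap_apply_def]
  simp only [Fin.ext_iff]
  split_ifs <;> rfl

theorem bruhatStep_reading_of_unitStep {n : ℕ} (hn : 2 ≤ n) {a b : Staircase (n - 2)}
    (h : UnitStep a.1 b.1) :
    BruhatStep (tableauOfStaircase hn a).reading (tableauOfStaircase hn b).reading := by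
  have ha := a.2
  have hb := b.2
  rcases h with ⟨h1, h2⟩ | ⟨h1, h2⟩
  -- In the reading of `a`, position `p + 2` holds the value `p + 2`, just above the middle entry `p
  -- + 1`. In the other case position `q + 2` holds `q + 1`, because `q < p`.
  · refine ⟨⟨1, by omega⟩, ⟨a.1.1 + 2, by omega⟩, by rw [Fin.lt_def]; dsimp only; omega, ?_, ?_⟩
    · rw [Fin.lt_def, reading_tableauOfStaircase_val, reading_tableauOfStaircase_val]
      grind (splits := 40) [complementFun]
    · ext x
      rw [Equiv.Perm.mul_apply, reading_tableauOfStaircase_val, reading_tableauOfStaircase_val,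
        swap_val, h1, h2]
      dsimp only
      grind (splits := 40) [complementFun]
  · refine ⟨⟨0, by omega⟩, ⟨a.1.2 + 2, by omega⟩, by rw [Fin.lt_def]; dsimp only; omega, ?_, ?_⟩
    · rw [Fin.lt_def, reading_tableauOfStaircase_val, reading_tableauOfStaircase_val]
      grind (splits := 40) [complementFun]
    · ext x
      rw [Equiv.Perm.mul_apply, reading_tableauOfStaircase_val, reading_tableauOfStaircase_val,
        swap_val, h1, h2]
      dsimp only
      grind (splits := 40) [complementFun]

theorem bruhatLE_reading_iff {n : ℕ} (hn : 2 ≤ n) (a b : Staircase (n - 2)) :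
    BruhatLE (tableauOfStaircase hn a).reading (tableauOfStaircase hn b).reading ↔ a ≤ b := by
  constructor
  · intro h
    obtain ⟨m, rfl⟩ := Nat.exists_eq_add_of_le' hn
    obtain ⟨h1, h2⟩ := h.apply_le
    have ha := a.2
    have hb := b.2
    have e0 : ((0 : Fin (m + 2)) : ℕ) = 0 := rfl
    have e1 : ((1 : Fin (m + 2)) : ℕ) = 1 := rfl
    have r0 : ∀ c, ((tableauOfStaircase hn c).reading 0).1 = c.1.2 := fun c => by
      rw [reading_tableauOfStaircase_val, e0, if_pos rfl]
    have r1 : ∀ c, ((tableauOfStaircase hn c).reading 1).1 = c.1.1 + 1 := fun c => by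
      rw [reading_tableauOfStaircase_val, e1, if_neg one_ne_zero, if_pos one_lt_two]
    have hm : ∀ c : Staircase (m + 2 - 2), max ((tableauOfStaircase hn c).reading 0)
        ((tableauOfStaircase hn c).reading 1) = (tableauOfStaircase hn c).reading 1 := fun c => by
      have := c.2
      rw [max_eq_right_iff, Fin.le_def, r0, r1]
      omega
    rw [hm, hm, Fin.le_def, r1, r1] at h2
    rw [Fin.le_def, r0, r0] at h1
    rw [Staircase.le_iff]
    omega
  · intro h
    have := Staircase.reflTransGen_of_le h
    exact Relation.ReflTransGen.lift (fun c => (tableauOfStaircase hn c).reading)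
      (fun _ _ => bruhatStep_reading_of_unitStep hn) _ _ this

/-- The row readings with the Bruhat order form a staircase. -/
noncomputable def staircaseOrderIsoRowReading {n : ℕ} (hn : 2 ≤ n) :
    Staircase (n - 2) ≃o RowReading n where
  toEquiv := Equiv.ofBijective (fun a => ⟨(tableauOfStaircase hn a).reading, _, rfl⟩) <| by
    constructor
    · intro a b h
      exact (staircaseOrderIsoTableau hn).injective
        (RecordingTableau.reading_injective (congrArg Subtype.val h))
    · rintro ⟨w, t, rfl⟩
      obtain ⟨a, rfl⟩ := (staircaseOrderIsoTableau hn).surjective t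
      exact ⟨a, rfl⟩
  map_rel_iff' := bruhatLE_reading_iff hn _ _

/-! ### Partitions in the box. -/

/-- The Young diagram with the row lengths `p ≥ q`. -/
def youngDiagramOfStaircase {k : ℕ} (a : Staircase k) : YoungDiagram where
  cells := (Finset.range 2 ×ˢ Finset.range k).filter fun c =>
    c.2 < if c.1 = 0 then a.1.1 else a.1.2
  isLowerSet := by
    rintro ⟨i, j⟩ ⟨i', j'⟩ h hij
    have ha := a.2
    obtain ⟨h1, h2⟩ := Prod.mk_le_mk.1 h
    simp only [Finset.coe_filter, Finset.mem_product, Finset.mem_range, Set.mem_ofPred_eq] at hij ⊢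
    split_ifs at * <;> omega

theorem mem_youngDiagramOfStaircase {k : ℕ} (a : Staircase k) (i j : ℕ) :
    (i, j) ∈ youngDiagramOfStaircase a ↔ (i = 0 ∧ j < a.1.1) ∨ (i = 1 ∧ j < a.1.2) := by
  have ha := a.2
  rw [← YoungDiagram.mem_cells]
  simp only [youngDiagramOfStaircase, Finset.mem_filter, Finset.mem_product, Finset.mem_range]
  split_ifs <;> omega

theorem rowLen_youngDiagramOfStaircase {k : ℕ} (a : Staircase k) :
    (youngDiagramOfStaircase a).rowLen 0 = a.1.1 ∧
      (youngDiagramOfStaircase a).rowLen 1 = a.1.2 := by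
  constructor <;> refine eq_of_forall_lt_iff fun j => ?_ <;>
    rw [← YoungDiagram.mem_iff_lt_rowLen, mem_youngDiagramOfStaircase] <;> simp

/-- The partitions with at most two rows and parts at most `k` form a staircase. -/
def staircaseOrderIsoFittedPartition (k : ℕ) : Staircase k ≃o FittedPartition k where
  toFun a := ⟨youngDiagramOfStaircase a, fun c hc => by
    simp only [youngDiagramOfStaircase, Finset.mem_filter, Finset.mem_product,
      Finset.mem_range] at hc
    exact hc.1⟩
  invFun μ := ⟨(μ.1.rowLen 0, μ.1.rowLen 1), μ.1.rowLen_anti _ _ zero_le_one, by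
    dsimp only
    by_contra h
    have := (μ.2 (0, k) ((YoungDiagram.mem_cells _).2
      (YoungDiagram.mem_iff_lt_rowLen.2 (not_le.1 h)))).2
    exact lt_irrefl _ this⟩
  left_inv a := Subtype.ext (Prod.ext (rowLen_youngDiagramOfStaircase a).1
    (rowLen_youngDiagramOfStaircase a).2)
  right_inv μ := by
    refine Subtype.ext (YoungDiagram.ext (Finset.ext ?_))
    rintro ⟨i, j⟩
    rw [YoungDiagram.mem_cells, YoungDiagram.mem_cells, mem_youngDiagramOfStaircase,
      ← YoungDiagram.mem_iff_lt_rowLen, ← YoungDiagram.mem_iff_lt_rowLen]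
    constructor
    · rintro (⟨rfl, h⟩ | ⟨rfl, h⟩) <;> exact h
    · intro h
      have := (μ.2 (i, j) ((YoungDiagram.mem_cells _).2 h)).1
      obtain rfl | rfl : i = 0 ∨ i = 1 := by
        dsimp only at this
        omega
      · exact .inl ⟨rfl, h⟩
      · exact .inr ⟨rfl, h⟩
  map_rel_iff' := by
    intro a b
    rw [Staircase.le_iff]
    change youngDiagramOfStaircase a ≤ youngDiagramOfStaircase b ↔ _
    constructor
    · intro h
      constructor <;> by_contra hc <;> rw [not_le] at hc
      · have := h ((mem_youngDiagramOfStaircase a 0 b.1.1).2 (.inl ⟨rfl, hc⟩))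
        rw [mem_youngDiagramOfStaircase] at this
        omega
      · have := h ((mem_youngDiagramOfStaircase a 1 b.1.2).2 (.inr ⟨rfl, hc⟩))
        rw [mem_youngDiagramOfStaircase] at this
        omega
    · rintro h ⟨i, j⟩ hij
      rw [mem_youngDiagramOfStaircase] at hij ⊢
      omega

/-! ### Lattice points of the dilated simplex. -/

theorem LatticePoint.add_le {k : ℕ} (a : LatticePoint k) : a.1.1 + a.1.2 ≤ k := by
  have : (a.1.1 : ℝ) + (a.1.2 : ℝ) ≤ k := a.2.2.2
  exact_mod_cast this

/-- The lattice point with nonnegative coordinates `x` and `y`. -/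
def latticePoint {k : ℕ} (x y : ℕ) (h : x + y ≤ k) : LatticePoint k :=
  ⟨(x, y), Nat.cast_nonneg _, Nat.cast_nonneg _, by
    change (x : ℝ) + (y : ℝ) ≤ k
    exact_mod_cast h⟩

theorem LatticePoint.lexCovers_iff {k : ℕ} {a b : LatticePoint k} :
    a.LexCovers b ↔ b.1.1 = a.1.1 + 1 := by
  unfold LexCovers LexLT
  constructor
  · rintro ⟨h1, h2⟩
    by_contra h
    have hb := b.add_le
    -- If the first coordinates differ by more than one, this point on the axis lies strictly
    -- between.
    refine h2 ⟨latticePoint (a.1.1 + 1) 0 (by omega), ?_, ?_⟩ <;>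
      simp only [latticePoint] <;> omega
  · intro h
    refine ⟨by omega, ?_⟩
    rintro ⟨c, h1, h2⟩
    omega

/-- A weight gain of one with `a₁` raised by one leaves `a₂` fixed; with `a₁` lowered by one it
raises `a₂` by one. -/
theorem LatticePoint.step_iff {k : ℕ} {a b : LatticePoint k} :
    a.Step b ↔ UnitStep (a.1.1 + a.1.2, a.1.2) (b.1.1 + b.1.2, b.1.2) := by
  unfold Step weight UnitStep
  rw [lexCovers_iff, lexCovers_iff]
  dsimp only
  omega

/-- The lattice point `(p - q, q)`. -/
def staircaseEquivLatticePoint (k : ℕ) : Staircase k ≃ LatticePoint k where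
  toFun a := latticePoint (a.1.1 - a.1.2) a.1.2 (by have := a.2; omega)
  invFun a := ⟨(a.1.1 + a.1.2, a.1.2), Nat.le_add_left _ _, a.add_le⟩
  left_inv a := by
    have := a.2
    exact Subtype.ext (Prod.ext (Nat.sub_add_cancel this.1) rfl)
  right_inv a := Subtype.ext (Prod.ext (Nat.add_sub_cancel _ _) rfl)

theorem step_staircaseEquivLatticePoint_iff {k : ℕ} (a b : Staircase k) :
    (staircaseEquivLatticePoint k a).Step (staircaseEquivLatticePoint k b) ↔
      UnitStep a.1 b.1 := by
  have ha := a.2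
  have hb := b.2
  rw [LatticePoint.step_iff]
  change UnitStep (a.1.1 - a.1.2 + a.1.2, a.1.2) (b.1.1 - b.1.2 + b.1.2, b.1.2) ↔ _
  rw [Nat.sub_add_cancel ha.1, Nat.sub_add_cancel hb.1]

/-- The lattice points of the dilated simplex form a staircase. -/
def staircaseOrderIsoLatticePoint (k : ℕ) : Staircase k ≃o LatticePoint k where
  toEquiv := staircaseEquivLatticePoint k
  map_rel_iff' := by
    intro a b
    change Relation.ReflTransGen LatticePoint.Step _ _ ↔ _
    constructor
    · intro h
      have := Relation.ReflTransGen.lift (r := LatticePoint.Step) (p := (· ≤ ·)) (staircaseEquivLatticePoint k).symm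
        (fun c d hcd => by
          obtain ⟨c, rfl⟩ := (staircaseEquivLatticePoint k).surjective c
          obtain ⟨d, rfl⟩ := (staircaseEquivLatticePoint k).surjective d
          rw [step_staircaseEquivLatticePoint_iff] at hcd
          rw [Function.onFun, Equiv.symm_apply_apply, Equiv.symm_apply_apply]
          exact (Staircase.covBy_iff.2 hcd).le) _ _ h
      rw [Function.onFun, Equiv.symm_apply_apply, Equiv.symm_apply_apply] at this
      rwa [Relation.reflTransGen_eq_self] at this
    · intro h
      exact Relation.ReflTransGen.lift (staircaseEquivLatticePoint k)
        (fun c d => (step_staircaseEquivLatticePoint_iff c d).2) _ _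
        (Staircase.reflTransGen_of_le h)

/-- The graph of lattice points is the Hasse diagram of the staircase. -/
def hasseStaircaseIsoLatticePointGraph (k : ℕ) :
    SimpleGraph.hasse (Staircase k) ≃g latticePointGraph k where
  toEquiv := staircaseEquivLatticePoint k
  map_rel_iff' := by
    intro a b
    rw [SimpleGraph.hasse_adj, Staircase.covBy_iff, Staircase.covBy_iff,
      ← step_staircaseEquivLatticePoint_iff, ← step_staircaseEquivLatticePoint_iff]
    rfl

/-! ### Assembling the isomorphisms. -/

/-- An order isomorphism is an isomorphism of Hasse diagrams. -/
def hasseIsoOfOrderIso {α β : Type*} [PartialOrder α] [PartialOrder β] (e : α ≃o β) :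
    SimpleGraph.hasse α ≃g SimpleGraph.hasse β where
  toEquiv := e.toEquiv
  map_rel_iff' := by
    intro a b
    exact or_congr (apply_covBy_apply_iff e) (apply_covBy_apply_iff e)

end HookWords

theorem mainTheorem3 (n k : ℕ) (hn : 4 ≤ n) (hk : k = n - 2) :
    Nonempty (HookWords.reducedWordGraph (HookWords.hookPerm n hn) ≃g
        SimpleGraph.hasse (HookWords.RecordingTableau n)) ∧
      Nonempty (SimpleGraph.hasse (HookWords.RecordingTableau n) ≃g
        SimpleGraph.hasse (HookWords.RowReading n)) ∧
      Nonempty (SimpleGraph.hasse (HookWords.RowReading n) ≃g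
        SimpleGraph.hasse (HookWords.FittedPartition k)) ∧
      Nonempty (SimpleGraph.hasse (HookWords.FittedPartition k) ≃g
        HookWords.latticePointGraph k) ∧
      ∃ f : HookWords.LatticePoint k ≃o HookWords.RowReading n,
        ∀ a b : HookWords.LatticePoint k,
          (HookWords.latticePointGraph k).Adj a b ↔
            (SimpleGraph.hasse (HookWords.RowReading n)).Adj (f a) (f b) := by
  subst hk
  have hn' : 2 ≤ n := by omega
  let eT := HookWords.staircaseOrderIsoTableau hn'
  let eR := HookWords.staircaseOrderIsoRowReading hn'
  let eP := HookWords.staircaseOrderIsoFittedPartition (n - 2)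
  let eL := HookWords.staircaseOrderIsoLatticePoint (n - 2)
  let gW := HookWords.hasseStaircaseIso hn
  let gT := HookWords.hasseIsoOfOrderIso eT
  let gR := HookWords.hasseIsoOfOrderIso eR
  let gP := HookWords.hasseIsoOfOrderIso eP
  let gL := HookWords.hasseStaircaseIsoLatticePointGraph (n - 2)
  refine ⟨⟨gW.symm.trans gT⟩, ⟨gT.symm.trans gR⟩, ⟨gR.symm.trans gP⟩, ⟨gP.symm.trans gL⟩,
    eL.symm.trans eR, fun a b => ?_⟩
  -- `gL` and `eL` share the bijection `staircaseEquivLatticePoint`, and `gR` comes from `eR`, so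
  -- the order isomorphism has the same underlying map as this graph isomorphism.
  exact (gL.symm.trans gR).map_rel_iff.symm
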